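/- \textbf{Setting.} All manifolds (Hausdorff, second countable, without boundary), maps and sections are $C^\infty$; sections are local, with open domain $U\subseteq M$. Let $\pi\colon E\to M$ be a surjective submersion, $\dim M=m$, $\dim E=m+n$, and let $\eta$ be a volume form on $M$. Let $\pi^1\colon J^1\pi\to E$ be the first-order jet bundle (pairs $(u,A)$ with $A\colon T_{\pi(u)}M\to T_uE$ linear and $T_u\pi\circ A=\mathrm{id}$) and $\bar\pi^1=\pi\circ\pi^1$. Let $\Lambda^m_r(T^*E)$ be the bundle of $m$-forms on $E$ that vanish when $r$ of their arguments are $\pi$-vertical, $J^1\pi^*=\Lambda^m_2(T^*E)/\Lambda^m_1(T^*E)$, $\mu\colon\Lambda^m_2(T^*E)\to J^1\pi^*$ the quotient map, $\pi^r_E\colon J^1\pi^*\to E$ the projection and $\bar\pi^r_E=\pi\circ\pi^r_E$. Let $\rho\colon N\to M$ be one of $\pi,\bar\pi^1,\bar\pi^r_E$ and $\mathcal D$ a field of tangent subspaces on $N$. A section $\psi$ of $\rho$ over $U$ is an \emph{integral section} of $\mathcal D$ if $T_x\psi(T_xM)=\mathcal D_{\psi(x)}$ for all $x\in U$; $\mathcal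 D$ is \emph{integrable} if through every point of $N$ passes an integral section, and \emph{$\rho$-transverse} if $\mathcal D_p\cap\ker T_p\rho=0$ for all $p$. For $S\subseteq N$, a section $\psi$ over $U$ has \emph{boundary conditions in} $S$ if either $\psi(x)\in S$ for some $x\in U$, or there is an open $O\subseteq M$ with $O\cap\partial U\neq\emptyset$ such that $\psi$ extends continuously to $U\cup(O\cap\partial U)$ with $\psi(O\cap\partial U)\subseteq S$. \textbf{(a) Lagrangian case.} Let $L\colon J^1\pi\to\mathbb R$ be smooth and let $\Theta_{\mathcal L}$ be the Poincaré–Cartan $m$-form of $\mathcal L=L\,\eta$: in adapted coordinates $(x^i,u^\alpha,u^\alpha_i)$, $$\Theta_{\mathcal L}=\sum_{i,\alpha}\frac{\partial L}{\partial u^\alpha_i}\,\Bigl(du^\alpha-\sum_k u^\alpha_k\,dx^k\Bigr)\wedge i(\partial/\partial x^i)\eta+L\,\eta ,\qquad \Omega_{\mathcal L}=-d\Theta_{\mathcal L}.$$ Let $\mathcal D_{\mathcal L}$ be a smooth, $m$-dimensional, $\bar\pi^1$-transverse, integrable distribution on $J^1\pi$ whose integral sections $\psi$ are all prolongations $j^1\phi$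 of sections $\phi$ of $\pi$ and satisfy $\psi^*i(X)\Omega_{\mathcal L}=0$ for every vector field $X$ on $J^1\pi$. Let $\Psi$ be a solution of the generalized Lagrangian Hamilton–Jacobi problem, i.e. a global section of $\pi^1$ that is integrable (through every $u\in E$ there is a section $\gamma$ of $\pi$ with $\Psi\circ\gamma=j^1\gamma$) and such that, for every integral section $\gamma$ of the distribution $\mathcal D=T\pi^1(\mathcal D_{\mathcal L}|_{\operatorname{Im}\Psi})$ on $E$, i.e. $\mathcal D_u=T_{\Psi(u)}\pi^1\bigl((\mathcal D_{\mathcal L})_{\Psi(u)}\bigr)$, the section $\Psi\circ\gamma$ is an integral section of $\mathcal D_{\mathcal L}$. Then the integral sections of $\mathcal D_{\mathcal L}$ with boundary conditions in $\operatorname{Im}\Psi$ project to the integral sections of $\mathcal D$: if $\psi$ is an integral section of $\mathcal D_{\mathcal L}$ over a connected open set $U$ with boundary conditions in $\operatorname{Im}\Psi$, then $\pi^1\circ\psi$ is an integral section of $\mathcal D$; and every integral section $\gamma$ of $\mathcal D$ over an open set $U$ is $\pi^1\circ\psi$ for an integral section $\psi$ of $\mathcal D_{\mathcal L}$ over $U$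 with $\psi(U)\subseteq\operatorname{Im}\Psi$. \textbf{(b) Hamiltonian case.} Let $h$ be a smooth section of $\mu$, $\Theta_h=h^*\Theta$ with $\Theta$ the tautological $m$-form of $\Lambda^m_2(T^*E)$, and $\Omega_h=-d\Theta_h$. Let $\mathcal D_h$ be a smooth, $m$-dimensional, $\bar\pi^r_E$-transverse, integrable distribution on $J^1\pi^*$ whose integral sections $\psi$ satisfy $\psi^*i(X)\Omega_h=0$ for every vector field $X$ on $J^1\pi^*$. Let $s$ be a solution of the generalized Hamiltonian Hamilton–Jacobi problem, i.e. a global section of $\pi^r_E$ such that the distribution $\mathcal D=T\pi^r_E(\mathcal D_h|_{\operatorname{Im}s})$ on $E$ is integrable and, for every integral section $\gamma$ of $\mathcal D$, the section $s\circ\gamma$ is an integral section of $\mathcal D_h$. Then the integral sections of $\mathcal D_h$ with boundary conditions in $\operatorname{Im}s$ project to the integral sections of $\mathcal D$: if $\psi$ is an integral section of $\mathcal D_h$ over a connected open set $U$ with boundary conditions in $\operatorname{Im}s$, then $\pi^r_E\circ\psi$ is an integral section of $\mathcal D$; and every integral section $\gamma$ of $\mathcal D$ over an open set $U$ is $\pi^r_E\circ\psi$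 for an integral section $\psi$ of $\mathcal D_h$ over $U$ with $\psi(U)\subseteq\operatorname{Im}s$. -/

import Mathlib

open Set Topology
open scoped Manifold ContDiff
set_option linter.unusedSectionVars false
noncomputable section
namespace FieldTheory

/-- The model space `ℝ^k`. -/
abbrev RSpace (k : ℕ) : Type := EuclideanSpace ℝ (Fin k)

section Frames
variable (H : Type*) [NormedAddCommGroup H] [NormedSpace ℝ H]
  {N : Type*} [TopologicalSpace N] [ChartedSpace H N]
  {W : Type*} [NormedAddCommGroup W] [NormedSpace ℝ W]
  {W' : Type*} [NormedAddCommGroup W'] [NormedSpace ℝ W']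

/-- The derivative of a chart `e` at `u`. -/
def chartD (e : OpenPartialHomeomorph N W) (u : N) : TangentSpace 𝓘(ℝ, H) u →L[ℝ] W :=
  mfderiv 𝓘(ℝ, H) 𝓘(ℝ, W) e u

/-- The inverse of the derivative of a chart `e` at `u`. -/
def chartDinv (e : OpenPartialHomeomorph N W) (u : N) : W →L[ℝ] TangentSpace 𝓘(ℝ, H) u :=
  (chartD H e u).inverse

variable {H}

/-- `e` is a chart of the smooth structure of `N`, with values in an arbitrary normed space. -/
structure IsSmoothChart (H : Type*) [NormedAddCommGroup H] [NormedSpace ℝ H]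
  {N : Type*} [TopologicalSpace N] [ChartedSpace H N]
  {W : Type*} [NormedAddCommGroup W] [NormedSpace ℝ W] (e : OpenPartialHomeomorph N W) : Prop where
  smooth : ContMDiffOn 𝓘(ℝ, H) 𝓘(ℝ, W) ∞ e e.source
  smooth_symm : ContMDiffOn 𝓘(ℝ, W) 𝓘(ℝ, H) ∞ e.symm e.target

variable {e : OpenPartialHomeomorph N W} {e' : OpenPartialHomeomorph N W'}

lemma IsSmoothChart.mdiff (he : IsSmoothChart H e) : e.MDifferentiable 𝓘(ℝ, H) 𝓘(ℝ, W) :=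
  ⟨he.smooth.mdifferentiableOn (by simp), he.smooth_symm.mdifferentiableOn (by simp)⟩

lemma IsSmoothChart.exists_equiv [IsManifold 𝓘(ℝ, H) ∞ N] (he : IsSmoothChart H e) {u : N} (hu : u ∈ e.source) :
    ∃ f : TangentSpace 𝓘(ℝ, H) u ≃L[ℝ] W, chartD H e u = f := by
  exact ⟨he.mdiff.mfderiv hu, rfl⟩

lemma IsSmoothChart.inv_comp [IsManifold 𝓘(ℝ, H) ∞ N] (he : IsSmoothChart H e) {u : N} (hu : u ∈ e.source) :
    (chartDinv H e u).comp (chartD H e u) = ContinuousLinearMap.id ℝ _ := by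
  obtain ⟨f, hf⟩ := he.exists_equiv hu
  rw [chartDinv, hf, ContinuousLinearMap.inverse_equiv]
  ext v; simp

lemma IsSmoothChart.comp_inv [IsManifold 𝓘(ℝ, H) ∞ N] (he : IsSmoothChart H e) {u : N} (hu : u ∈ e.source) :
    (chartD H e u).comp (chartDinv H e u) = ContinuousLinearMap.id ℝ _ := by
  obtain ⟨f, hf⟩ := he.exists_equiv hu
  rw [chartDinv, hf, ContinuousLinearMap.inverse_equiv]
  ext v; simp

lemma chartD_transition [IsManifold 𝓘(ℝ, H) ∞ N] (he : IsSmoothChart H e) (he' : IsSmoothChart H e')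
    {u : N} (hu : u ∈ e.source) (hu' : u ∈ e'.source) :
    (chartD H e' u).comp (chartDinv H e u) = fderiv ℝ (e' ∘ e.symm) (e u) := by
  have h1 : MDifferentiableAt 𝓘(ℝ, H) 𝓘(ℝ, W') e' u := he'.mdiff.mdifferentiableAt hu'
  have h2 : MDifferentiableAt 𝓘(ℝ, W) 𝓘(ℝ, H) e.symm (e u) :=
    he.mdiff.symm.mdifferentiableAt (e.map_source hu)
  have h3 : (mfderiv 𝓘(ℝ, H) 𝓘(ℝ, W') e' u) = ((fderiv ℝ (e' ∘ e.symm) (e u)).comp (chartD H e u)) := by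
    have h4 : MDifferentiableAt 𝓘(ℝ, W) 𝓘(ℝ, W') (e' ∘ e.symm) (e u) := by
      apply MDifferentiableAt.comp (I' := 𝓘(ℝ, H)) (e u) _ h2
      rwa [e.left_inv hu]
    have h5 := mfderiv_comp (I' := 𝓘(ℝ, W)) u h4 (he.mdiff.mdifferentiableAt hu)
    rw [mfderiv_eq_fderiv] at h5
    refine Eq.trans ?_ h5
    apply Filter.EventuallyEq.mfderiv_eq
    filter_upwards [e.open_source.mem_nhds hu] with y hy
    simp [e.left_inv hy]
  have h6 : chartD H e' u = ((fderiv ℝ (e' ∘ e.symm) (e u)).comp (chartD H e u)) := h3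
  rw [h6, ContinuousLinearMap.comp_assoc, he.comp_inv hu, ContinuousLinearMap.comp_id]

lemma transition_contDiffOn [IsManifold 𝓘(ℝ, H) ∞ N] (he : IsSmoothChart H e) (he' : IsSmoothChart H e') :
    ContDiffOn ℝ ∞ (e' ∘ e.symm) (e.target ∩ e.symm ⁻¹' e'.source) := by
  rw [← contMDiffOn_iff_contDiffOn]
  exact he'.smooth.comp (he.smooth_symm.mono inter_subset_left) inter_subset_right

lemma transition_isOpen :
    IsOpen (e.target ∩ e.symm ⁻¹' e'.source) := by
  exact e.symm.isOpen_inter_preimage e'.open_source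

end Frames

variable (m n : ℕ)
  {M : Type*} [TopologicalSpace M] [ChartedSpace (RSpace m) M] 
  {E : Type*} [TopologicalSpace E] [ChartedSpace (RSpace (m + n)) E] 

/-- `π : E → M` is a fibered manifold: a surjective submersion, with `dim M = m`, `dim E = m + n`. -/
class FiberedManifold (π : E → M) : Prop where
  surjective : Function.Surjective π
  submersion : Manifold.IsSubmersion 𝓘(ℝ, RSpace (m + n)) 𝓘(ℝ, RSpace m) ∞ π

/-- Adapted coordinates `(x^i, u^α)` on `E`, together with the coordinates `(x^i)` on `M`. -/
structure AdaptedChart (π : E → M) where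
  tot : OpenPartialHomeomorph E (RSpace m × RSpace n)
  base : OpenPartialHomeomorph M (RSpace m)
  smooth_tot : IsSmoothChart (RSpace (m + n)) tot
  smooth_base : IsSmoothChart (RSpace m) base
  maps : ∀ u ∈ tot.source, π u ∈ base.source
  fst_eq : ∀ u ∈ tot.source, (tot u).1 = base (π u)

variable {m n}

lemma exists_adaptedChart [IsManifold 𝓘(ℝ, RSpace m) ∞ M] [IsManifold 𝓘(ℝ, RSpace (m + n)) ∞ E]
    (π : E → M) [h : FiberedManifold m n π] (u : E) :
    ∃ a : AdaptedChart m n π, u ∈ a.tot.source := by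
  obtain ⟨F, _, _, hF⟩ := h.submersion
  have hu := hF u
  have hfd : FiniteDimensional ℝ (RSpace m × F) := hu.equiv.toLinearEquiv.finiteDimensional
  have : FiniteDimensional ℝ F :=
    FiniteDimensional.of_injective (LinearMap.inr ℝ (RSpace m) F) LinearMap.inr_injective
  have hd : Module.finrank ℝ F = n := by
    have := hu.equiv.toLinearEquiv.finrank_eq
    simp at this
    omega
  let g : F ≃L[ℝ] RSpace n := ContinuousLinearEquiv.ofFinrankEq (by simp [hd])
  let L : RSpace (m + n) ≃L[ℝ] RSpace m × RSpace n :=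
    hu.equiv.trans ((ContinuousLinearEquiv.refl ℝ _).prodCongr g)
  refine ⟨⟨hu.domChart.trans L.toHomeomorph.toOpenPartialHomeomorph, hu.codChart, ⟨?_, ?_⟩, ⟨?_, ?_⟩, ?_, ?_⟩, ?_⟩
  · have := contMDiffOn_of_mem_maximalAtlas hu.domChart_mem_maximalAtlas
    have hL : ContMDiff 𝓘(ℝ, RSpace (m + n)) 𝓘(ℝ, RSpace m × RSpace n) ∞ L := L.contDiff.contMDiff
    simpa using hL.comp_contMDiffOn this
  · have := contMDiffOn_symm_of_mem_maximalAtlas hu.domChart_mem_maximalAtlas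
    have hL : ContMDiff 𝓘(ℝ, RSpace m × RSpace n) 𝓘(ℝ, RSpace (m + n)) ∞ L.symm := L.symm.contDiff.contMDiff
    exact this.comp hL.contMDiffOn (by intro x hx; simpa using hx)
  · exact contMDiffOn_of_mem_maximalAtlas hu.codChart_mem_maximalAtlas
  · exact contMDiffOn_symm_of_mem_maximalAtlas hu.codChart_mem_maximalAtlas
  · intro x hx
    exact hu.source_subset_preimage_source (by simpa using hx)
  · intro x hx
    have hx' : x ∈ hu.domChart.source := by simpa using hx
    have hm : hu.domChart x ∈ (hu.domChart.extend 𝓘(ℝ, RSpace (m + n))).target := by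
      simpa using hu.domChart.map_source hx'
    have := hu.writtenInCharts hm
    simp [hu.domChart.left_inv hx'] at this
    simp [L, this]
  · simpa using hu.mem_domChart_source


section Jets

variable [IsManifold 𝓘(ℝ, RSpace m) ∞ M] [IsManifold 𝓘(ℝ, RSpace (m + n)) ∞ E]
  {π : E → M}

lemma AdaptedChart.fst_comp (hπ : MDifferentiable 𝓘(ℝ, RSpace (m + n)) 𝓘(ℝ, RSpace m) π)
    (a : AdaptedChart m n π) {u : E} (hu : u ∈ a.tot.source) :
    (ContinuousLinearMap.fst ℝ (RSpace m) (RSpace n)).comp (chartD (RSpace (m + n)) a.tot u) =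
      (chartD (RSpace m) a.base (π u)).comp
        (mfderiv 𝓘(ℝ, RSpace (m + n)) 𝓘(ℝ, RSpace m) π u) := by
  have h1 : mfderiv 𝓘(ℝ, RSpace (m + n)) 𝓘(ℝ, RSpace m) (Prod.fst ∘ a.tot) u =
      mfderiv 𝓘(ℝ, RSpace (m + n)) 𝓘(ℝ, RSpace m) (a.base ∘ π) u := by
    apply Filter.EventuallyEq.mfderiv_eq
    filter_upwards [a.tot.open_source.mem_nhds hu] with y hy
    exact a.fst_eq y hy
  have h2 : mfderiv 𝓘(ℝ, RSpace (m + n)) 𝓘(ℝ, RSpace m) (a.base ∘ π) u =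
      (chartD (RSpace m) a.base (π u)).comp
        (mfderiv 𝓘(ℝ, RSpace (m + n)) 𝓘(ℝ, RSpace m) π u) :=
    mfderiv_comp u (a.smooth_base.mdiff.mdifferentiableAt (a.maps u hu)) (hπ u)
  have h3 : MDifferentiableAt 𝓘(ℝ, RSpace m × RSpace n) 𝓘(ℝ, RSpace m)
      (Prod.fst : RSpace m × RSpace n → RSpace m) (a.tot u) :=
    (ContinuousLinearMap.fst ℝ (RSpace m) (RSpace n)).mdifferentiableAt
  have h4 : mfderiv 𝓘(ℝ, RSpace (m + n)) 𝓘(ℝ, RSpace m) (Prod.fst ∘ a.tot) u =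
      (mfderiv 𝓘(ℝ, RSpace m × RSpace n) 𝓘(ℝ, RSpace m)
        (Prod.fst : RSpace m × RSpace n → RSpace m) (a.tot u)).comp
        (chartD (RSpace (m + n)) a.tot u) :=
    mfderiv_comp u h3 (a.smooth_tot.mdiff.mdifferentiableAt hu)
  have h5 : mfderiv 𝓘(ℝ, RSpace m × RSpace n) 𝓘(ℝ, RSpace m)
        (Prod.fst : RSpace m × RSpace n → RSpace m) (a.tot u) =
        ContinuousLinearMap.fst ℝ (RSpace m) (RSpace n) := by
    rw [mfderiv_eq_fderiv]; exact fderiv_fst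
  refine Eq.trans ?_ (h4.symm.trans (h1.trans h2))
  exact congrArg (fun q : RSpace m × RSpace n →L[ℝ] RSpace m =>
    q.comp (chartD (RSpace (m + n)) a.tot u)) h5.symm

lemma FiberedManifold.contMDiff {π : E → M} [h : FiberedManifold m n π] :
    ContMDiff 𝓘(ℝ, RSpace (m + n)) 𝓘(ℝ, RSpace m) ∞ π :=
  h.submersion.contMDiff

lemma FiberedManifold.mdifferentiable (π : E → M) [h : FiberedManifold m n π] :
    MDifferentiable 𝓘(ℝ, RSpace (m + n)) 𝓘(ℝ, RSpace m) π :=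
  (FiberedManifold.contMDiff (m := m) (n := n) (π := π)).mdifferentiable (by simp)

variable (m n π) in
/-- The fibre of `π¹ : J¹π → E` over `u`: the `1`-jets at `π u` of local sections through `u`,
i.e. the linear maps `A : T_{π u}M → T_uE` with `Tπ ∘ A = id`. -/
def JetFiber (u : E) : Type :=
  {A : TangentSpace 𝓘(ℝ, RSpace m) (π u) →L[ℝ] TangentSpace 𝓘(ℝ, RSpace (m + n)) u //
    (mfderiv 𝓘(ℝ, RSpace (m + n)) 𝓘(ℝ, RSpace m) π u).comp A = ContinuousLinearMap.id ℝ _}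

variable (m n π) in
/-- The first-order jet bundle `J¹π`. -/
@[ext] structure Jet where
  pt : E
  lin : JetFiber m n π pt

variable (m n) in
/-- The model space of the coordinates `(x^i, u^α, u_i^α)` of `J¹π`. -/
abbrev JetModel : Type := (RSpace m × RSpace n) × (RSpace m →L[ℝ] RSpace n)

/-- The coordinates `((x^i, u^α), u_i^α)` of a jet. -/
def AdaptedChart.jetCoord (a : AdaptedChart m n π) (j : Jet m n π) : JetModel m n :=
  (a.tot j.pt, (ContinuousLinearMap.snd ℝ (RSpace m) (RSpace n)).comp
    ((chartD (RSpace (m + n)) a.tot j.pt).comp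
      (j.lin.1.comp (chartDinv (RSpace m) a.base (π j.pt)))))

/-- The linear map over `u` with coordinates `u_i^α = B`. -/
def AdaptedChart.jetLin (a : AdaptedChart m n π) (u : E) (B : RSpace m →L[ℝ] RSpace n) :
    TangentSpace 𝓘(ℝ, RSpace m) (π u) →L[ℝ] TangentSpace 𝓘(ℝ, RSpace (m + n)) u :=
  (chartDinv (RSpace (m + n)) a.tot u).comp
    (((ContinuousLinearMap.id ℝ (RSpace m)).prod B).comp (chartD (RSpace m) a.base (π u)))

lemma AdaptedChart.jetLin_prop [FiberedManifold m n π] (a : AdaptedChart m n π) {u : E}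
    (hu : u ∈ a.tot.source) (B : RSpace m →L[ℝ] RSpace n) :
    (mfderiv 𝓘(ℝ, RSpace (m + n)) 𝓘(ℝ, RSpace m) π u).comp (a.jetLin u B) =
      ContinuousLinearMap.id ℝ _ := by
  have h1 := a.fst_comp (FiberedManifold.mdifferentiable π) hu
  have h2 := a.smooth_base.inv_comp (a.maps u hu)
  have h3 := a.smooth_tot.comp_inv hu
  ext1 v
  have e1 := fun w => DFunLike.congr_fun h1 w
  have e2 := fun w => DFunLike.congr_fun h2 w
  have e3 := fun w => DFunLike.congr_fun h3 w
  simp only [ContinuousLinearMap.comp_apply, ContinuousLinearMap.id_apply] at e1 e2 e3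
  rw [ContinuousLinearMap.comp_apply, ← e2 (mfderiv 𝓘(ℝ, RSpace (m + n)) 𝓘(ℝ, RSpace m) π u (a.jetLin u B v)), ← e1]
  simp only [jetLin, ContinuousLinearMap.comp_apply, e3]
  exact e2 v

lemma nonempty_jetFiber [FiberedManifold m n π] (u : E) : Nonempty (JetFiber m n π u) := by
  obtain ⟨a, ha⟩ := exists_adaptedChart (m := m) (n := n) π u
  exact ⟨⟨a.jetLin (m := m) (n := n) u 0, a.jetLin_prop ha 0⟩⟩

open Classical in
/-- The jet with given coordinates. -/
def AdaptedChart.jetOfCoord [FiberedManifold m n π] (a : AdaptedChart m n π) (z : JetModel m n) :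
    Jet m n π where
  pt := a.tot.symm z.1
  lin := if h : a.tot.symm z.1 ∈ a.tot.source then
      ⟨a.jetLin (a.tot.symm z.1) z.2, a.jetLin_prop h z.2⟩
    else (nonempty_jetFiber (a.tot.symm z.1)).some

lemma AdaptedChart.jetOfCoord_lin [FiberedManifold m n π] (a : AdaptedChart m n π)
    (z : JetModel m n) (h : a.tot.symm z.1 ∈ a.tot.source) :
    (a.jetOfCoord z).lin.1 = a.jetLin (a.tot.symm z.1) z.2 :=
  congrArg Subtype.val (dif_pos h)

/-- The chart `(x^i, u^α, u_i^α)` of `J¹π` induced by an adapted chart of `E`. -/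
def AdaptedChart.jetChart [FiberedManifold m n π] (a : AdaptedChart m n π) :
    PartialEquiv (Jet m n π) (JetModel m n) where
  toFun := a.jetCoord
  invFun := a.jetOfCoord
  source := {j | j.pt ∈ a.tot.source}
  target := {z | z.1 ∈ a.tot.target}
  map_source' j hj := a.tot.map_source hj
  map_target' z hz := a.tot.map_target hz
  left_inv' := by
    rintro ⟨u, A⟩ (hu : u ∈ a.tot.source)
    have key : a.jetLin u (a.jetCoord ⟨u, A⟩).2 = A.1 := by
      have h1 := a.fst_comp (FiberedManifold.mdifferentiable π) hu
      have h2 := a.smooth_base.inv_comp (a.maps u hu)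
      have h3 := a.smooth_tot.inv_comp hu
      ext1 v
      have e1 := fun w => DFunLike.congr_fun h1 w
      have e2 := fun w => DFunLike.congr_fun h2 w
      have e3 := fun w => DFunLike.congr_fun h3 w
      have e4 := fun w => DFunLike.congr_fun A.2 w
      simp only [ContinuousLinearMap.comp_apply, ContinuousLinearMap.id_apply] at e1 e2 e3 e4
      have : ((ContinuousLinearMap.id ℝ (RSpace m)).prod (a.jetCoord ⟨u, A⟩).2)
          (chartD (RSpace m) a.base (π u) v) = chartD (RSpace (m + n)) a.tot u (A.1 v) := by
        refine Prod.ext ?_ ?_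
        · exact ((e1 _).trans (congrArg _ (e4 v))).symm
        · simp only [jetCoord, ContinuousLinearMap.prod_apply, ContinuousLinearMap.comp_apply]
          rw [e2]; rfl
      simp only [jetLin, ContinuousLinearMap.comp_apply, this, e3]
    have hpt : a.tot.symm (a.tot u) = u := a.tot.left_inv hu
    have : ∀ u' (_ : u' = u) (A' : JetFiber m n π u'),
        A'.1 = a.jetLin u' (a.jetCoord ⟨u, A⟩).2 → (⟨u', A'⟩ : Jet m n π) = ⟨u, A⟩ := by
      rintro u' rfl A' hA'
      congr 1
      exact Subtype.ext (hA'.trans key)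
    refine this _ hpt (a.jetOfCoord (a.jetCoord ⟨u, A⟩)).lin (a.jetOfCoord_lin _ ?_)
    exact hpt.symm ▸ hu
  right_inv' := by
    rintro ⟨z, B⟩ (hz : z ∈ a.tot.target)
    have hu : a.tot.symm z ∈ a.tot.source := a.tot.map_target hz
    have h2 := a.smooth_base.comp_inv (a.maps _ hu)
    have h3 := a.smooth_tot.comp_inv hu
    have e2 := fun w => DFunLike.congr_fun h2 w
    have e3 := fun w => DFunLike.congr_fun h3 w
    simp only [ContinuousLinearMap.comp_apply, ContinuousLinearMap.id_apply] at e2 e3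
    refine Prod.ext (a.tot.right_inv hz) ?_
    ext1 v
    have hl := a.jetOfCoord_lin (z, B) hu
    simp only [jetCoord, hl, ContinuousLinearMap.comp_apply, jetLin]
    change (chartD (RSpace (m + n)) a.tot (a.tot.symm z) (chartDinv (RSpace (m + n)) a.tot
      (a.tot.symm z) ((ContinuousLinearMap.id ℝ (RSpace m)).prod B
      (chartD (RSpace m) a.base (π (a.tot.symm z)) (chartDinv (RSpace m) a.base
        (π (a.tot.symm z)) v))))).2 = B v
    rw [e3, e2]
    rfl

lemma AdaptedChart.jetChart_trans_source [FiberedManifold m n π] (a b : AdaptedChart m n π) :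
    (a.jetChart.symm.trans b.jetChart).source =
      (a.tot.target ∩ a.tot.symm ⁻¹' b.tot.source) ×ˢ univ := by
  ext z
  have : (a.jetChart.symm.trans b.jetChart).source =
    {z | z.1 ∈ a.tot.target ∧ a.tot.symm z.1 ∈ b.tot.source} := rfl
  rw [this]
  simp

lemma AdaptedChart.contDiffOn_jet [FiberedManifold m n π] (a b : AdaptedChart m n π) :
    ContDiffOn ℝ ∞ (a.jetChart.symm.trans b.jetChart)
      (a.jetChart.symm.trans b.jetChart).source := by
  rw [a.jetChart_trans_source b]
  set S := a.tot.target ∩ a.tot.symm ⁻¹' b.tot.source with hS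
  have hSo : IsOpen S := transition_isOpen
  set τ := b.tot ∘ a.tot.symm with hτ
  have hτs : ContDiffOn ℝ ∞ τ S := transition_contDiffOn a.smooth_tot b.smooth_tot
  set S' := b.base.target ∩ b.base.symm ⁻¹' a.base.source with hS'
  have hSo' : IsOpen S' := transition_isOpen
  set σ := a.base ∘ b.base.symm with hσ
  have hσs : ContDiffOn ℝ ∞ σ S' := transition_contDiffOn b.smooth_base a.smooth_base
  have hmaps : ∀ z ∈ S, (τ z).1 ∈ S' := by
    rintro z ⟨hz, hz'⟩
    have hb := b.fst_eq _ hz'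
    have hm := b.maps _ hz'
    have hma := a.maps _ (a.tot.map_target hz)
    simp only [hτ, Function.comp, hb, hS', mem_inter_iff, mem_preimage]
    exact ⟨b.base.map_source hm, by rwa [b.base.left_inv hm]⟩
  have hform : EqOn (a.jetChart.symm.trans b.jetChart)
      (fun z => (τ z.1, (ContinuousLinearMap.snd ℝ (RSpace m) (RSpace n)).comp
        ((fderiv ℝ τ z.1).comp (((ContinuousLinearMap.id ℝ (RSpace m)).prod z.2).comp
          (fderiv ℝ σ (τ z.1).1))))) (S ×ˢ univ) := by
    rintro ⟨z, B⟩ ⟨⟨hz, hz'⟩, -⟩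
    have hu : a.tot.symm z ∈ a.tot.source := a.tot.map_target hz
    refine Prod.ext rfl ?_
    have t1 := chartD_transition a.smooth_tot b.smooth_tot hu hz'
    have t2 := chartD_transition b.smooth_base a.smooth_base (b.maps _ hz') (a.maps _ hu)
    rw [a.tot.right_inv hz] at t1
    have hb : b.base (π (a.tot.symm z)) = (τ z).1 := (b.fst_eq _ hz').symm
    rw [hb] at t2
    change (ContinuousLinearMap.snd ℝ (RSpace m) (RSpace n)).comp
      ((chartD (RSpace (m + n)) b.tot (a.tot.symm z)).comp
      ((a.jetOfCoord (z, B)).lin.1.comp (chartDinv (RSpace m) b.base (π (a.tot.symm z))))) = _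
    rw [a.jetOfCoord_lin (z, B) hu]
    change _ = (ContinuousLinearMap.snd ℝ (RSpace m) (RSpace n)).comp
        ((fderiv ℝ τ z).comp (((ContinuousLinearMap.id ℝ (RSpace m)).prod B).comp
          (fderiv ℝ σ (τ z).1)))
    rw [hτ, hσ, ← t1, ← t2]
    rfl
  refine ContDiffOn.congr ?_ hform
  have hfst : ContDiffOn ℝ ∞ (fun z : JetModel m n => z.1) (S ×ˢ univ) := contDiff_fst.contDiffOn
  have m1 : MapsTo (fun z : JetModel m n => z.1) (S ×ˢ univ) S := fun z hz => hz.1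
  have c1 : ContDiffOn ℝ ∞ (fun z : JetModel m n => τ z.1) (S ×ˢ univ) := hτs.comp hfst m1
  have c2 : ContDiffOn ℝ ∞ (fun z : JetModel m n => fderiv ℝ τ z.1) (S ×ˢ univ) :=
    (hτs.fderiv_of_isOpen hSo (m := ∞) (by simp)).comp hfst m1
  have c3 : ContDiffOn ℝ ∞ (fun z : JetModel m n => fderiv ℝ σ (τ z.1).1) (S ×ˢ univ) :=
    (hσs.fderiv_of_isOpen hSo' (m := ∞) (by simp)).comp c1.fst (fun z hz => hmaps _ hz.1)
  have c4 : ContDiffOn ℝ ∞ (fun z : JetModel m n => (ContinuousLinearMap.id ℝ (RSpace m)).prod z.2)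
      (S ×ˢ univ) := by
    have : ContDiff ℝ ∞ (fun z : JetModel m n =>
        (ContinuousLinearMap.inl ℝ (RSpace m) (RSpace n)) +
          (ContinuousLinearMap.inr ℝ (RSpace m) (RSpace n)).comp z.2) :=
      contDiff_const.add (contDiff_const.clm_comp contDiff_snd)
    refine this.contDiffOn.congr fun z _ => ?_
    ext1 v
    simp
  exact c1.prodMk (contDiffOn_const.clm_comp (c2.clm_comp (c4.clm_comp c3)))

variable (m n π) in
/-- A chosen adapted chart around `u`. -/
def chartNear [FiberedManifold m n π] (u : E) : AdaptedChart m n π := (exists_adaptedChart π u).choose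

lemma mem_chartNear [FiberedManifold m n π] (u : E) : u ∈ (chartNear m n π u).tot.source :=
  (exists_adaptedChart π u).choose_spec

variable (m n π) in
/-- The smooth atlas of `J¹π` given by the induced charts. -/
def jetCore [FiberedManifold m n π] : ChartedSpaceCore (JetModel m n) (Jet m n π) where
  atlas := range AdaptedChart.jetChart
  chartAt j := (chartNear m n π j.pt).jetChart
  mem_chart_source j := mem_chartNear (m := m) (n := n) j.pt
  chart_mem_atlas j := ⟨_, rfl⟩
  open_source := by
    rintro _ _ ⟨a, rfl⟩ ⟨b, rfl⟩
    rw [a.jetChart_trans_source b]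
    exact transition_isOpen.prod isOpen_univ
  continuousOn_toFun := by
    rintro _ _ ⟨a, rfl⟩ ⟨b, rfl⟩
    exact (a.contDiffOn_jet b).continuousOn

instance [FiberedManifold m n π] : TopologicalSpace (Jet m n π) := (jetCore m n π).toTopologicalSpace
instance [FiberedManifold m n π] : ChartedSpace (JetModel m n) (Jet m n π) := (jetCore m n π).toChartedSpace

lemma isManifold_of_core {H : Type*} [NormedAddCommGroup H] [NormedSpace ℝ H] {N : Type*}
    (c : ChartedSpaceCore H N)
    (h : ∀ e e' : PartialEquiv N H, e ∈ c.atlas → e' ∈ c.atlas →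
      ContDiffOn ℝ ∞ (e.symm.trans e') (e.symm.trans e').source) :
    @IsManifold ℝ _ H _ _ H _ 𝓘(ℝ, H) ∞ N c.toTopologicalSpace c.toChartedSpace := by
  let := c.toTopologicalSpace
  let := c.toChartedSpace
  refine isManifold_of_contDiffOn 𝓘(ℝ, H) ∞ N ?_
  intro e e' he he'
  change e ∈ ⋃ (e : PartialEquiv N H) (he : e ∈ c.atlas), {c.openPartialHomeomorph e he} at he
  change e' ∈ ⋃ (e : PartialEquiv N H) (he : e ∈ c.atlas), {c.openPartialHomeomorph e he} at he'
  simp only [mem_iUnion, mem_singleton_iff] at he he'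
  obtain ⟨f, hf, rfl⟩ := he
  obtain ⟨f', hf', rfl⟩ := he'
  have := h f f' hf hf'
  simp only [modelWithCornersSelf_coe, modelWithCornersSelf_coe_symm, Function.id_comp,
    Function.comp_id, range_id, inter_univ, preimage_id]
  exact this

instance [FiberedManifold m n π] : IsManifold 𝓘(ℝ, JetModel m n) ∞ (Jet m n π) := by
  apply isManifold_of_core
  rintro _ _ ⟨a, rfl⟩ ⟨b, rfl⟩
  exact a.contDiffOn_jet b
end Jets
section VerticalForms

variable {V V' V'' B B' B'' : Type*}
  [AddCommGroup V] [Module ℝ V] [TopologicalSpace V] [AddCommGroup B] [Module ℝ B] [TopologicalSpace B]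
  [AddCommGroup V'] [Module ℝ V'] [TopologicalSpace V'] [AddCommGroup B'] [Module ℝ B'] [TopologicalSpace B']
  [AddCommGroup V''] [Module ℝ V''] [TopologicalSpace V''] [AddCommGroup B''] [Module ℝ B'']
  [TopologicalSpace B'']

/-- The `m`-forms on `V` which vanish when `r` of their arguments are `p`-vertical
(`Λ^m_r` for `p = T_uπ`). -/
def verticalForms (p : V →L[ℝ] B) (m r : ℕ) : Submodule ℝ (V [⋀^Fin m]→L[ℝ] ℝ) where
  carrier := {α | ∀ (v : Fin m → V) (s : Finset (Fin m)), s.card = r → (∀ i ∈ s, p (v i) = 0) → α v = 0}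
  add_mem' {α α'} h h' v s hs hv := by simp [h v s hs hv, h' v s hs hv]
  zero_mem' v s _ _ := by simp
  smul_mem' c α h v s hs hv := by simp [h v s hs hv]

/-- `Λ^m_2 / Λ^m_1`, as the image of `Λ^m_2` in the quotient of all `m`-forms by `Λ^m_1`. -/
def ReducedForms (p : V →L[ℝ] B) (m : ℕ) :
    Submodule ℝ ((V [⋀^Fin m]→L[ℝ] ℝ) ⧸ verticalForms p m 1) :=
  (verticalForms p m 2).map (verticalForms p m 1).mkQ

/-- The class of an element of `Λ^m_2`. -/
def reducedClass (p : V →L[ℝ] B) (m : ℕ) (α : verticalForms p m 2) : ReducedForms p m :=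
  ⟨(verticalForms p m 1).mkQ α.1, Submodule.mem_map_of_mem α.2⟩

lemma exists_reducedClass {p : V →L[ℝ] B} {m : ℕ} (k : ReducedForms p m) :
    ∃ α, reducedClass p m α = k := by
  obtain ⟨_, α, hα, rfl⟩ := k
  exact ⟨⟨α, hα⟩, rfl⟩

lemma reducedClass_eq {p : V →L[ℝ] B} {m : ℕ} {α β : verticalForms p m 2}
    (h : α.1 - β.1 ∈ verticalForms p m 1) : reducedClass p m α = reducedClass p m β :=
  Subtype.ext ((Submodule.Quotient.eq _).2 h)

lemma pull_mem {p : V →L[ℝ] B} {p' : V' →L[ℝ] B'} {m r : ℕ} {L : V →L[ℝ] V'}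
    (h : ∀ v, p v = 0 → p' (L v) = 0) {α : V' [⋀^Fin m]→L[ℝ] ℝ} (hα : α ∈ verticalForms p' m r) :
    α.compContinuousLinearMap L ∈ verticalForms p m r :=
  fun v s hs hv => hα (fun i => L (v i)) s hs fun i hi => h _ (hv i hi)

open Classical in
/-- Pull-back of classes by a linear map preserving vertical vectors. -/
def pullReduced (p : V →L[ℝ] B) (p' : V' →L[ℝ] B') (m : ℕ) (L : V →L[ℝ] V')
    (k : ReducedForms p' m) : ReducedForms p m :=
  if h : ∀ v, p v = 0 → p' (L v) = 0 then
    reducedClass p m ⟨(exists_reducedClass k).choose.1.compContinuousLinearMap L,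
      pull_mem h (exists_reducedClass k).choose.2⟩
  else 0

lemma pullReduced_mk {p : V →L[ℝ] B} {p' : V' →L[ℝ] B'} {m : ℕ} {L : V →L[ℝ] V'}
    (h : ∀ v, p v = 0 → p' (L v) = 0) (α : verticalForms p' m 2) :
    pullReduced p p' m L (reducedClass p' m α) =
      reducedClass p m ⟨α.1.compContinuousLinearMap L, pull_mem h α.2⟩ := by
  rw [pullReduced, dif_pos h]
  have h1 := (exists_reducedClass (reducedClass p' m α)).choose_spec
  have h2 := (Submodule.Quotient.eq _).1 (congrArg Subtype.val h1)
  exact reducedClass_eq (pull_mem h h2)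

lemma pullReduced_comp {p : V →L[ℝ] B} {p' : V' →L[ℝ] B'} {p'' : V'' →L[ℝ] B''} {m : ℕ}
    {L : V →L[ℝ] V'} {L' : V' →L[ℝ] V''}
    (h : ∀ v, p v = 0 → p' (L v) = 0) (h' : ∀ v, p' v = 0 → p'' (L' v) = 0) (k : ReducedForms p'' m) :
    pullReduced p p' m L (pullReduced p' p'' m L' k) = pullReduced p p'' m (L'.comp L) k := by
  obtain ⟨α, rfl⟩ := exists_reducedClass k
  have hc : ∀ v, p v = 0 → p'' ((L'.comp L) v) = 0 := fun v hv => h' _ (h v hv)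
  rw [pullReduced_mk h', pullReduced_mk h, pullReduced_mk hc]
  rfl

lemma pullReduced_id {p : V →L[ℝ] B} {m : ℕ} (k : ReducedForms p m) :
    pullReduced p p m (ContinuousLinearMap.id ℝ V) k = k := by
  obtain ⟨α, rfl⟩ := exists_reducedClass k
  rw [pullReduced_mk fun v hv => hv]
  rfl

end VerticalForms

variable (m n) in
/-- The projection `ℝ^m × ℝ^n → ℝ^m`. -/
abbrev modelProj : RSpace m × RSpace n →L[ℝ] RSpace m := ContinuousLinearMap.fst ℝ (RSpace m) (RSpace n)

variable (m n) in
lemma finiteDimensional_forms : FiniteDimensional ℝ ((RSpace m × RSpace n) [⋀^Fin m]→L[ℝ] ℝ) := by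
  let f : ((RSpace m × RSpace n) [⋀^Fin m]→L[ℝ] ℝ) →ₗ[ℝ]
      MultilinearMap ℝ (fun _ : Fin m => RSpace m × RSpace n) ℝ :=
    { toFun := fun α => α.toMultilinearMap
      map_add' := fun _ _ => rfl
      map_smul' := fun _ _ => rfl }
  refine FiniteDimensional.of_injective f fun α β h => ?_
  ext v
  exact congrArg (fun g : MultilinearMap ℝ (fun _ : Fin m => RSpace m × RSpace n) ℝ => g v) h

variable (m n) in
/-- The model fibre of `J¹π*`. -/
def MomentumModel : Type := ReducedForms (modelProj m n) m

instance : IsClosed ((verticalForms (modelProj m n) m 1 : Submodule ℝ _) :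
    Set ((RSpace m × RSpace n) [⋀^Fin m]→L[ℝ] ℝ)) := by
  have := finiteDimensional_forms m n
  exact Submodule.closed_of_finiteDimensional _

instance : NormedAddCommGroup (MomentumModel m n) :=
  inferInstanceAs (NormedAddCommGroup (ReducedForms (modelProj m n) m))

instance : NormedSpace ℝ (MomentumModel m n) where
  toModule := inferInstanceAs (Module ℝ (ReducedForms (modelProj m n) m))
  norm_smul_le c k := norm_smul_le c k.1

lemma exists_pull_formula : ∃ (s : MomentumModel m n →L[ℝ] (RSpace m × RSpace n) [⋀^Fin m]→L[ℝ] ℝ)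
    (q : ((RSpace m × RSpace n) [⋀^Fin m]→L[ℝ] ℝ) →L[ℝ] MomentumModel m n),
    ∀ (L : RSpace m × RSpace n →L[ℝ] RSpace m × RSpace n),
      (∀ v, modelProj m n v = 0 → modelProj m n (L v) = 0) → ∀ k : MomentumModel m n,
      (pullReduced (modelProj m n) (modelProj m n) m L k : MomentumModel m n) =
        q ((s k).compContinuousLinearMap L) := by
  have := finiteDimensional_forms m n
  let P2 := verticalForms (modelProj m n) m 2
  let Q : P2 →ₗ[ℝ] MomentumModel m n :=
    { toFun := reducedClass (modelProj m n) m
      map_add' := fun _ _ => rfl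
      map_smul' := fun _ _ => rfl }
  obtain ⟨S, hS⟩ := Q.exists_rightInverse_of_surjective
    (LinearMap.range_eq_top.2 fun k => exists_reducedClass k)
  have : FiniteDimensional ℝ P2 := FiniteDimensional.finiteDimensional_submodule P2
  have : FiniteDimensional ℝ (MomentumModel m n) :=
    Module.Finite.of_surjective Q fun k => exists_reducedClass k
  obtain ⟨q₀, hq₀⟩ := LinearMap.exists_extend Q
  let s₀ : MomentumModel m n →ₗ[ℝ] (RSpace m × RSpace n) [⋀^Fin m]→L[ℝ] ℝ := P2.subtype.comp S
  refine ⟨LinearMap.toContinuousLinearMap s₀, LinearMap.toContinuousLinearMap q₀, fun L hL k => ?_⟩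
  have hk : reducedClass (modelProj m n) m (S k) = k := LinearMap.congr_fun hS k
  have h1 := pullReduced_mk hL (S k)
  rw [hk] at h1
  refine h1.trans ?_
  exact (LinearMap.congr_fun hq₀ ⟨(S k).1.compContinuousLinearMap L, pull_mem hL (S k).2⟩).symm

variable (m n) in
lemma contDiff_compCLM :
    ContDiff ℝ ∞ (fun z : ((RSpace m × RSpace n) [⋀^Fin m]→L[ℝ] ℝ) ×
      (RSpace m × RSpace n →L[ℝ] RSpace m × RSpace n) => z.1.compContinuousLinearMap z.2) := by
  let CM := ContinuousMultilinearMap ℝ (fun _ : Fin m => RSpace m × RSpace n) ℝ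
  have hfd : FiniteDimensional ℝ CM := by
    let f : CM →ₗ[ℝ] MultilinearMap ℝ (fun _ : Fin m => RSpace m × RSpace n) ℝ :=
      { toFun := fun α => α.toMultilinearMap
        map_add' := fun _ _ => rfl
        map_smul' := fun _ _ => rfl }
    refine FiniteDimensional.of_injective f fun α β h => ?_
    ext v
    exact congrArg (fun g : MultilinearMap ℝ (fun _ : Fin m => RSpace m × RSpace n) ℝ => g v) h
  let i : ((RSpace m × RSpace n) [⋀^Fin m]→L[ℝ] ℝ) →L[ℝ] CM :=
    ContinuousAlternatingMap.toContinuousMultilinearMapCLM ℝ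
  obtain ⟨P, hP⟩ := LinearMap.exists_leftInverse_of_injective i.toLinearMap
    (LinearMap.ker_eq_bot.2 ContinuousAlternatingMap.toContinuousMultilinearMap_injective)
  have h1 : ContDiff ℝ ∞ (fun z : ((RSpace m × RSpace n) [⋀^Fin m]→L[ℝ] ℝ) ×
      (RSpace m × RSpace n →L[ℝ] RSpace m × RSpace n) =>
      ContinuousMultilinearMap.compContinuousLinearMapContinuousMultilinear ℝ
        (fun _ : Fin m => RSpace m × RSpace n) (fun _ => RSpace m × RSpace n) ℝ
        (fun _ => z.2) (i z.1)) := by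
    refine ContDiff.clm_apply ?_ (i.contDiff.comp contDiff_fst)
    exact (ContinuousMultilinearMap.contDiff _).comp (contDiff_pi.2 fun _ => contDiff_snd)
  have h2 := (LinearMap.toContinuousLinearMap P).contDiff.comp h1
  convert h2 using 1
  funext z
  exact (LinearMap.congr_fun hP (z.1.compContinuousLinearMap z.2)).symm

section DualJets

variable [IsManifold 𝓘(ℝ, RSpace m) ∞ M] [IsManifold 𝓘(ℝ, RSpace (m + n)) ∞ E]
  {π : E → M}

variable (m n π) in
/-- The restricted multimomentum bundle `J¹π* = Λ^m_2(T^*E) / Λ^m_1(T^*E)`. -/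
@[ext] structure DualJet where
  pt : E
  cls : ReducedForms (mfderiv 𝓘(ℝ, RSpace (m + n)) 𝓘(ℝ, RSpace m) π pt) m

variable (m n) in
/-- The model space of the coordinates `(x^i, u^α, p_α^i)` of `J¹π*`. -/
abbrev DualJetModel : Type := (RSpace m × RSpace n) × MomentumModel m n

lemma AdaptedChart.vert_chartD [FiberedManifold m n π] (a : AdaptedChart m n π) {u : E}
    (hu : u ∈ a.tot.source) (v : TangentSpace 𝓘(ℝ, RSpace (m + n)) u)
    (hv : mfderiv 𝓘(ℝ, RSpace (m + n)) 𝓘(ℝ, RSpace m) π u v = 0) :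
    modelProj m n (chartD (RSpace (m + n)) a.tot u v) = 0 := by
  have h1 := DFunLike.congr_fun (a.fst_comp (FiberedManifold.mdifferentiable π) hu) v
  refine h1.trans ?_
  rw [ContinuousLinearMap.comp_apply, hv, map_zero]

lemma AdaptedChart.vert_chartDinv [FiberedManifold m n π] (a : AdaptedChart m n π) {u : E}
    (hu : u ∈ a.tot.source) (w : RSpace m × RSpace n) (hw : modelProj m n w = 0) :
    mfderiv 𝓘(ℝ, RSpace (m + n)) 𝓘(ℝ, RSpace m) π u (chartDinv (RSpace (m + n)) a.tot u w) = 0 := by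
  have h1 := DFunLike.congr_fun (a.fst_comp (FiberedManifold.mdifferentiable π) hu)
    (chartDinv (RSpace (m + n)) a.tot u w)
  have h3 := DFunLike.congr_fun (a.smooth_tot.comp_inv hu) w
  have h2 := DFunLike.congr_fun (a.smooth_base.inv_comp (a.maps u hu))
    (mfderiv 𝓘(ℝ, RSpace (m + n)) 𝓘(ℝ, RSpace m) π u (chartDinv (RSpace (m + n)) a.tot u w))
  simp only [ContinuousLinearMap.comp_apply, ContinuousLinearMap.id_apply] at h1 h2 h3
  rw [h3] at h1
  rw [← h2, ← h1]
  exact (congrArg _ hw).trans (map_zero _)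

/-- The coordinates of an element of `J¹π*`. -/
def AdaptedChart.dualCoord (a : AdaptedChart m n π) (q : DualJet m n π) : DualJetModel m n :=
  (a.tot q.pt, pullReduced (modelProj m n) (mfderiv 𝓘(ℝ, RSpace (m + n)) 𝓘(ℝ, RSpace m) π q.pt) m
    (chartDinv (RSpace (m + n)) a.tot q.pt) q.cls)

/-- The element of `J¹π*` with given coordinates. -/
def AdaptedChart.dualOfCoord (a : AdaptedChart m n π) (z : DualJetModel m n) : DualJet m n π where
  pt := a.tot.symm z.1
  cls := pullReduced (mfderiv 𝓘(ℝ, RSpace (m + n)) 𝓘(ℝ, RSpace m) π (a.tot.symm z.1))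
    (modelProj m n) m (chartD (RSpace (m + n)) a.tot (a.tot.symm z.1)) z.2

/-- The chart of `J¹π*` induced by an adapted chart of `E`. -/
def AdaptedChart.dualChart [FiberedManifold m n π] (a : AdaptedChart m n π) :
    PartialEquiv (DualJet m n π) (DualJetModel m n) where
  toFun := a.dualCoord
  invFun := a.dualOfCoord
  source := {q | q.pt ∈ a.tot.source}
  target := {z | z.1 ∈ a.tot.target}
  map_source' q hq := a.tot.map_source hq
  map_target' z hz := a.tot.map_target hz
  left_inv' := by
    rintro ⟨u, k⟩ (hu : u ∈ a.tot.source)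
    have key := pullReduced_comp (m := m) (a.vert_chartD hu) (a.vert_chartDinv hu) k
    rw [a.smooth_tot.inv_comp hu, pullReduced_id] at key
    have : ∀ u' (_ : u' = u), (⟨u', pullReduced (mfderiv 𝓘(ℝ, RSpace (m + n)) 𝓘(ℝ, RSpace m) π u')
        (modelProj m n) m (chartD (RSpace (m + n)) a.tot u') (a.dualCoord ⟨u, k⟩).2⟩ :
        DualJet m n π) = ⟨u, k⟩ := by
      rintro u' rfl
      exact congrArg _ key
    exact this _ (a.tot.left_inv hu)
  right_inv' := by
    rintro ⟨z, k⟩ (hz : z ∈ a.tot.target)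
    have hu : a.tot.symm z ∈ a.tot.source := a.tot.map_target hz
    refine Prod.ext (a.tot.right_inv hz) ?_
    have key := pullReduced_comp (m := m) (a.vert_chartDinv hu) (a.vert_chartD hu) k
    rw [a.smooth_tot.comp_inv hu] at key
    exact key.trans (pullReduced_id _)

lemma AdaptedChart.dualChart_trans_source [FiberedManifold m n π] (a b : AdaptedChart m n π) :
    (a.dualChart.symm.trans b.dualChart).source =
      (a.tot.target ∩ a.tot.symm ⁻¹' b.tot.source) ×ˢ univ := by
  ext z
  have : (a.dualChart.symm.trans b.dualChart).source =
    {z | z.1 ∈ a.tot.target ∧ a.tot.symm z.1 ∈ b.tot.source} := rfl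
  rw [this]
  simp

lemma AdaptedChart.contDiffOn_dual [FiberedManifold m n π] (a b : AdaptedChart m n π) :
    ContDiffOn ℝ ∞ (a.dualChart.symm.trans b.dualChart)
      (a.dualChart.symm.trans b.dualChart).source := by
  rw [a.dualChart_trans_source b]
  obtain ⟨s, q, hsq⟩ := exists_pull_formula (m := m) (n := n)
  set S := a.tot.target ∩ a.tot.symm ⁻¹' b.tot.source with hS
  set τ := b.tot ∘ a.tot.symm with hτ
  have hτs : ContDiffOn ℝ ∞ τ S := transition_contDiffOn a.smooth_tot b.smooth_tot
  set S' := b.tot.target ∩ b.tot.symm ⁻¹' a.tot.source with hS'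
  have hSo' : IsOpen S' := transition_isOpen
  set σ := a.tot ∘ b.tot.symm with hσ
  have hσs : ContDiffOn ℝ ∞ σ S' := transition_contDiffOn b.smooth_tot a.smooth_tot
  have hmaps : MapsTo τ S S' := by
    rintro z ⟨hz, hz'⟩
    simp only [hτ, Function.comp, hS', mem_inter_iff, mem_preimage]
    exact ⟨b.tot.map_source hz', by rw [b.tot.left_inv hz']; exact a.tot.map_target hz⟩
  have hform : EqOn (a.dualChart.symm.trans b.dualChart)
      (fun z => (τ z.1, q ((s z.2).compContinuousLinearMap (fderiv ℝ σ (τ z.1))))) (S ×ˢ univ) := by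
    rintro ⟨z, k⟩ ⟨⟨hz, hz'⟩, -⟩
    have hu : a.tot.symm z ∈ a.tot.source := a.tot.map_target hz
    refine Prod.ext rfl ?_
    have t1 := chartD_transition b.smooth_tot a.smooth_tot hz' hu
    have key := pullReduced_comp (m := m) (b.vert_chartDinv hz') (a.vert_chartD hu) k
    refine key.trans ((hsq _ ?_ k).trans ?_)
    · exact fun v hv => a.vert_chartD hu _ (b.vert_chartDinv hz' v hv)
    · rw [t1]; rfl
  refine ContDiffOn.congr ?_ hform
  have hfst : ContDiffOn ℝ ∞ (fun z : DualJetModel m n => z.1) (S ×ˢ univ) := contDiff_fst.contDiffOn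
  have m1 : MapsTo (fun z : DualJetModel m n => z.1) (S ×ˢ univ) S := fun z hz => hz.1
  have c1 : ContDiffOn ℝ ∞ (fun z : DualJetModel m n => τ z.1) (S ×ˢ univ) := hτs.comp hfst m1
  have c2 : ContDiffOn ℝ ∞ (fun z : DualJetModel m n => fderiv ℝ σ (τ z.1)) (S ×ˢ univ) :=
    (hσs.fderiv_of_isOpen hSo' (m := ∞) (by simp)).comp c1 (fun z hz => hmaps hz.1)
  have c3 : ContDiffOn ℝ ∞ (fun z : DualJetModel m n => s z.2) (S ×ˢ univ) :=
    (s.contDiff.comp contDiff_snd).contDiffOn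
  exact c1.prodMk (q.contDiff.comp_contDiffOn ((contDiff_compCLM m n).comp_contDiffOn (c3.prodMk c2)))

variable (m n π) in
/-- The smooth atlas of `J¹π*` given by the induced charts. -/
def dualCore [FiberedManifold m n π] : ChartedSpaceCore (DualJetModel m n) (DualJet m n π) where
  atlas := range AdaptedChart.dualChart
  chartAt q := (chartNear m n π q.pt).dualChart
  mem_chart_source q := mem_chartNear (m := m) (n := n) q.pt
  chart_mem_atlas q := ⟨_, rfl⟩
  open_source := by
    rintro _ _ ⟨a, rfl⟩ ⟨b, rfl⟩
    rw [a.dualChart_trans_source b]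
    exact transition_isOpen.prod isOpen_univ
  continuousOn_toFun := by
    rintro _ _ ⟨a, rfl⟩ ⟨b, rfl⟩
    exact (a.contDiffOn_dual b).continuousOn

instance [FiberedManifold m n π] : TopologicalSpace (DualJet m n π) :=
  (dualCore m n π).toTopologicalSpace
instance [FiberedManifold m n π] : ChartedSpace (DualJetModel m n) (DualJet m n π) :=
  (dualCore m n π).toChartedSpace

instance [FiberedManifold m n π] : IsManifold 𝓘(ℝ, DualJetModel m n) ∞ (DualJet m n π) := by
  apply isManifold_of_core
  rintro _ _ ⟨a, rfl⟩ ⟨b, rfl⟩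
  exact a.contDiffOn_dual b
end DualJets
section Distributions

variable {H : Type*} [NormedAddCommGroup H] [NormedSpace ℝ H]
  {N : Type*} [TopologicalSpace N] [ChartedSpace H N]

/-- `X` is a smooth vector field on the open set `V`. -/
def IsSmoothVectorFieldOn [IsManifold 𝓘(ℝ, H) ∞ N] (X : ∀ p : N, TangentSpace 𝓘(ℝ, H) p)
    (V : Set N) : Prop :=
  ContMDiffOn 𝓘(ℝ, H) 𝓘(ℝ, H).tangent ∞ (fun p => (⟨p, X p⟩ : TangentBundle 𝓘(ℝ, H) N)) V

/-- A smooth distribution of rank `k`, i.e. a rank `k` smooth vector subbundle of `TN`: locally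
spanned by `k` linearly independent smooth vector fields. -/
def IsSmoothDistribution [IsManifold 𝓘(ℝ, H) ∞ N] (k : ℕ)
    (D : ∀ p : N, Submodule ℝ (TangentSpace 𝓘(ℝ, H) p)) : Prop :=
  ∀ p : N, ∃ V : Set N, IsOpen V ∧ p ∈ V ∧
    ∃ Z : Fin k → ∀ q : N, TangentSpace 𝓘(ℝ, H) q,
      (∀ i, IsSmoothVectorFieldOn (Z i) V) ∧
      ∀ q ∈ V, LinearIndependent ℝ (fun i => Z i q) ∧
        Submodule.span ℝ (range fun i => Z i q) = D q

/-- `D` is transverse to the projection `ρ : N → M`: it contains no nonzero `ρ`-vertical vector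
(for `rank D = dim M` this says that `Tρ` maps `D p` isomorphically onto the tangent space). -/
def IsTransverse (ρ : N → M) (D : ∀ p : N, Submodule ℝ (TangentSpace 𝓘(ℝ, H) p)) : Prop :=
  ∀ p : N, ∀ w ∈ D p, mfderiv 𝓘(ℝ, H) 𝓘(ℝ, RSpace m) ρ p w = 0 → w = 0

/-- `ψ` is a smooth local section of `ρ : N → M` with open domain `U`. -/
structure IsLocalSection (ρ : N → M) (U : Set M) (ψ : M → N) : Prop where
  isOpen : IsOpen U
  smooth : ContMDiffOn 𝓘(ℝ, RSpace m) 𝓘(ℝ, H) ∞ ψ U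
  right_inv : ∀ x ∈ U, ρ (ψ x) = x

/-- `ψ` is a local integral section of `D` over `U`: at each point of its image, the tangent space
of the image is the subspace given by `D`. -/
structure IsIntegralSection (ρ : N → M) (D : ∀ p : N, Submodule ℝ (TangentSpace 𝓘(ℝ, H) p))
    (U : Set M) (ψ : M → N) : Prop extends
    IsLocalSection (m := m) (H := H) ρ U ψ where
  tangent : ∀ x ∈ U, (mfderiv 𝓘(ℝ, RSpace m) 𝓘(ℝ, H) ψ x).range = D (ψ x)

/-- Integrability of a distribution `D` of rank `dim M` transverse to `ρ : N → M`: there is an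
integral manifold through every point. By transversality the integral manifolds are, locally,
the images of the integral sections. -/
def IsIntegrable (ρ : N → M) (D : ∀ p : N, Submodule ℝ (TangentSpace 𝓘(ℝ, H) p)) : Prop :=
  ∀ p : N, ∃ (U : Set M) (ψ : M → N),
    ρ p ∈ U ∧ ψ (ρ p) = p ∧ IsIntegralSection (m := m) ρ D U ψ

/-- The local section `ψ` over `U` has boundary conditions in `S`: either it takes a value
in `S` somewhere in `U` (data prescribed inside the domain, e.g. on a hypersurface), or it extends
continuously to a nonempty relatively open part `O ∩ ∂U` of the boundary of `U`, with
boundary values in `S`. -/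
def HasBoundaryConditionsIn (U : Set M) (ψ : M → N) (S : Set N) : Prop :=
  (∃ x ∈ U, ψ x ∈ S) ∨
  ∃ O : Set M, IsOpen O ∧ (O ∩ frontier U).Nonempty ∧ ContinuousOn ψ (U ∪ (O ∩ frontier U)) ∧
    MapsTo ψ (O ∩ frontier U) S

end Distributions

section DifferentialForms

variable {H : Type*} [NormedAddCommGroup H] [NormedSpace ℝ H]
  {N : Type*} [TopologicalSpace N] [ChartedSpace H N] {k : ℕ}

/-- The expression of a `k`-form on `N` in the preferred chart at `p`. -/
def formInChart (ξ : ∀ p : N, TangentSpace 𝓘(ℝ, H) p [⋀^Fin k]→L[ℝ] ℝ) (p : N) :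
    H → H [⋀^Fin k]→L[ℝ] ℝ := fun z =>
  (ξ ((chartAt H p).symm z)).compContinuousLinearMap
    (mfderiv 𝓘(ℝ, H) 𝓘(ℝ, H) (chartAt H p).symm z)

/-- Smooth `k`-forms. -/
def IsSmoothForm (ξ : ∀ p : N, TangentSpace 𝓘(ℝ, H) p [⋀^Fin k]→L[ℝ] ℝ) : Prop :=
  ∀ p : N, ContDiffOn ℝ ∞ (formInChart ξ p) (chartAt H p).target

/-- The exterior derivative of a `k`-form on a manifold, computed in charts. -/
def exteriorDerivative (ξ : ∀ p : N, TangentSpace 𝓘(ℝ, H) p [⋀^Fin k]→L[ℝ] ℝ) (p : N) :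
    TangentSpace 𝓘(ℝ, H) p [⋀^Fin (k + 1)]→L[ℝ] ℝ :=
  (extDeriv (formInChart ξ p) (chartAt H p p)).compContinuousLinearMap
    (mfderiv 𝓘(ℝ, H) 𝓘(ℝ, H) (chartAt H p) p)

/-- A volume form on `M`: a smooth nowhere vanishing form of top degree. -/
structure IsVolumeForm (η : ∀ x : M, TangentSpace 𝓘(ℝ, RSpace m) x [⋀^Fin m]→L[ℝ] ℝ) : Prop where
  smooth : IsSmoothForm η
  ne_zero : ∀ x, η x ≠ 0

/-- The field equation `ψ^*(i(X)Ω) = 0` on `U`, for every vector field `X` on `N`, where `Ω` is an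
`(m+1)`-form on `N` and `ψ` is a local section over `U`. -/
def SolvesFieldEquation [IsManifold 𝓘(ℝ, H) ∞ N]
    (Ω : ∀ p : N, TangentSpace 𝓘(ℝ, H) p [⋀^Fin (m + 1)]→L[ℝ] ℝ) (U : Set M) (ψ : M → N) : Prop :=
  ∀ X : ∀ p : N, TangentSpace 𝓘(ℝ, H) p, IsSmoothVectorFieldOn X univ →
    ∀ x ∈ U, ∀ v : Fin m → TangentSpace 𝓘(ℝ, RSpace m) x,
      Ω (ψ x) (Matrix.vecCons (X (ψ x))
        (fun i => mfderiv 𝓘(ℝ, RSpace m) 𝓘(ℝ, H) ψ x (v i))) = 0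

variable {V W : Type*} [AddCommGroup V] [Module ℝ V] [TopologicalSpace V]
  [AddCommGroup W] [Module ℝ W] [TopologicalSpace W]

/-- The form `(w₁, …, w_k) ↦ ∑ i, β (S w₁, …, T wᵢ, …, S w_k)`. If `T = ∑ θ^α ⊗ P_α` then this is
`∑ θ^α ∧ S^*(i(P_α)β)`. -/
def insertForm (S T : V →L[ℝ] W) (β : W [⋀^Fin k]→L[ℝ] ℝ) : V [⋀^Fin k]→L[ℝ] ℝ where
  toContinuousMultilinearMap := ∑ i : Fin k,
    β.toContinuousMultilinearMap.compContinuousLinearMap (fun l => if l = i then T else S)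
  map_eq_zero_of_eq' := by
    intro w a b hw hab
    have hsum : (∑ i : Fin k, β.toContinuousMultilinearMap.compContinuousLinearMap
        (fun l => if l = i then T else S)) w =
        ∑ i : Fin k, β (fun l => (if l = i then T else S) (w l)) :=
      sum_apply _ _ w
    refine hsum.trans ?_
    rw [Finset.sum_eq_add a b hab]
    · have hswap := β.toAlternatingMap.map_swap (fun l => (if l = a then T else S) (w l)) hab
      have hfun : (fun l => (if l = a then T else S) (w l)) ∘ Equiv.swap a b =
          fun l => (if l = b then T else S) (w l) := by
        funext l
        by_cases h1 : l = a
        · subst h1; simp [hab, hab.symm, hw]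
        by_cases h2 : l = b
        · subst h2; simp [hw]
        · simp [Equiv.swap_apply_of_ne_of_ne h1 h2, h1, h2]
      rw [hfun] at hswap
      refine (congrArg (fun t => β (fun l => (if l = a then T else S) (w l)) + t) hswap).trans ?_
      exact add_neg_cancel _
    · intro i _ hi
      refine β.map_eq_zero_of_eq _ (i := a) (j := b) ?_ hab
      simp [hi.1.symm, hi.2.symm, hw]
    · simp
    · simp

end DifferentialForms

section Lagrangian

variable [IsManifold 𝓘(ℝ, RSpace m) ∞ M] [IsManifold 𝓘(ℝ, RSpace (m + n)) ∞ E]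
  {π : E → M} [FiberedManifold m n π]

/-- The projection `π¹ : J¹π → E`. -/
def jetProj (j : Jet m n π) : E := j.pt

/-- The projection `π̄¹ = π ∘ π¹ : J¹π → M`. -/
def jetBase (j : Jet m n π) : M := π j.pt

/-- The tangent map `T_jπ¹`. -/
def tangentJetProj (j : Jet m n π) :
    TangentSpace 𝓘(ℝ, JetModel m n) j →L[ℝ] TangentSpace 𝓘(ℝ, RSpace (m + n)) j.pt :=
  mfderiv 𝓘(ℝ, JetModel m n) 𝓘(ℝ, RSpace (m + n)) (jetProj : Jet m n π → E) j

/-- The tangent map `T_jπ̄¹`. -/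
def tangentJetBase (j : Jet m n π) :
    TangentSpace 𝓘(ℝ, JetModel m n) j →L[ℝ] TangentSpace 𝓘(ℝ, RSpace m) (π j.pt) :=
  mfderiv 𝓘(ℝ, JetModel m n) 𝓘(ℝ, RSpace m) (jetBase : Jet m n π → M) j

/-- The contact (structure) form of `J¹π` at `j = (u, A)`: the vertical-valued `1`-form
`w ↦ Tπ¹ w - A (Tπ̄¹ w)`, in coordinates `(d u^α - u_i^α d x^i) ⊗ ∂/∂u^α`. -/
def contactForm (j : Jet m n π) :
    TangentSpace 𝓘(ℝ, JetModel m n) j →L[ℝ] TangentSpace 𝓘(ℝ, RSpace (m + n)) j.pt :=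
  tangentJetProj j - j.lin.1.comp (tangentJetBase j)

/-- The fibre derivative of `L` at `j` in the direction `d x^i ⊗ y`, i.e. `y ↦ y^α ∂L/∂u_i^α (j)`, in
the bundle coordinates of `J¹π` at `j`. -/
def fiberDerivative (L : Jet m n π → ℝ) (j : Jet m n π) (i : Fin m) : RSpace n →L[ℝ] ℝ :=
  (mfderiv 𝓘(ℝ, JetModel m n) 𝓘(ℝ, ℝ) L j).comp
    ((chartDinv (JetModel m n) (chartAt (JetModel m n) j) j).comp
      ((ContinuousLinearMap.inr ℝ (RSpace m × RSpace n) (RSpace m →L[ℝ] RSpace n)).comp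
        (ContinuousLinearMap.smulRightL ℝ (RSpace m) (RSpace n)
          (EuclideanSpace.proj i : RSpace m →L[ℝ] ℝ))))

/-- The endomorphism-type tensor `∑ i, (∂L/∂u_i^α θ^α) ⊗ ∂/∂x^i` at `j`, where `θ^α` are the
components of the contact form. It does not depend on the adapted coordinates. -/
def legendreTensor (L : Jet m n π → ℝ) (j : Jet m n π) :
    TangentSpace 𝓘(ℝ, JetModel m n) j →L[ℝ] TangentSpace 𝓘(ℝ, RSpace m) (π j.pt) :=
  ∑ i : Fin m, ((fiberDerivative L j i).comp
    ((ContinuousLinearMap.snd ℝ (RSpace m) (RSpace n)).comp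
      ((chartD (RSpace (m + n)) (chartNear m n π j.pt).tot j.pt).comp
        (contactForm j)))).smulRight
      (chartDinv (RSpace m) (chartNear m n π j.pt).base (π j.pt) (EuclideanSpace.single i 1))

/-- The Poincaré–Cartan `m`-form `Θ_𝓛 = ∂L/∂u_i^α θ^α ∧ i(∂/∂x^i)η + L η` of the Lagrangian
density `𝓛 = L η`, where `θ^α = d u^α - u_i^α d x^i`. -/
def cartanForm (η : ∀ x : M, TangentSpace 𝓘(ℝ, RSpace m) x [⋀^Fin m]→L[ℝ] ℝ)
    (L : Jet m n π → ℝ) (j : Jet m n π) :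
    TangentSpace 𝓘(ℝ, JetModel m n) j [⋀^Fin m]→L[ℝ] ℝ :=
  L j • (η (π j.pt)).compContinuousLinearMap (tangentJetBase j) +
    insertForm (tangentJetBase j) (legendreTensor L j) (η (π j.pt))

/-- The Poincaré–Cartan `(m+1)`-form `Ω_𝓛 = -dΘ_𝓛`. -/
def cartanMultisymplecticForm (η : ∀ x : M, TangentSpace 𝓘(ℝ, RSpace m) x [⋀^Fin m]→L[ℝ] ℝ)
    (L : Jet m n π → ℝ) (j : Jet m n π) :
    TangentSpace 𝓘(ℝ, JetModel m n) j [⋀^Fin (m + 1)]→L[ℝ] ℝ :=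
  -exteriorDerivative (cartanForm η L) j

/-- `A` is the `1`-jet at `x` of the local section `φ`, i.e. `A = T_x φ` (stated as
`A ∘ T_x(π ∘ φ) = T_x φ`, where `π ∘ φ` is the identity near `x`). -/
def IsJetAt (φ : M → E) (x : M) (A : JetFiber m n π (φ x)) : Prop :=
  A.1.comp (mfderiv 𝓘(ℝ, RSpace m) 𝓘(ℝ, RSpace m) (fun y => π (φ y)) x) =
    mfderiv 𝓘(ℝ, RSpace m) 𝓘(ℝ, RSpace (m + n)) φ x

/-- `ψ = j¹φ` on `U`. -/
def IsProlongation (U : Set M) (φ : M → E) (ψ : M → Jet m n π) : Prop :=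
  ∀ x ∈ U, ∃ A : JetFiber m n π (φ x), IsJetAt φ x A ∧ ψ x = ⟨φ x, A⟩

/-- `D` is a solution of the Lagrangian problem of the Lagrangian density `L η`: an `m`-dimensional,
`π̄¹`-transverse and integrable distribution in `J¹π` whose integral sections are holonomic and
satisfy `ψ^* i(X)Ω_𝓛 = 0` for every vector field `X` on `J¹π`. -/
structure SolvesLagrangianProblem
    (η : ∀ x : M, TangentSpace 𝓘(ℝ, RSpace m) x [⋀^Fin m]→L[ℝ] ℝ) (L : Jet m n π → ℝ)
    (D : ∀ j : Jet m n π, Submodule ℝ (TangentSpace 𝓘(ℝ, JetModel m n) j)) : Prop where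
  isSmooth : IsSmoothDistribution m D
  isTransverse : IsTransverse (m := m) (jetBase : Jet m n π → M) D
  isIntegrable : IsIntegrable (m := m) (jetBase : Jet m n π → M) D
  holonomic : ∀ (U : Set M) (ψ : M → Jet m n π), IsIntegralSection (m := m) jetBase D U ψ →
    ∃ φ : M → E, IsLocalSection (m := m) (H := RSpace (m + n)) π U φ ∧ IsProlongation U φ ψ
  fieldEquation : ∀ (U : Set M) (ψ : M → Jet m n π), IsIntegralSection (m := m) jetBase D U ψ →
    SolvesFieldEquation (cartanMultisymplecticForm η L) U ψ

/-- The section `u ↦ (u, Ψ u)` of `π¹ : J¹π → E` given by a field of `1`-jets. -/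
def jetLift (Ψ : ∀ u : E, JetFiber m n π u) (u : E) : Jet m n π := ⟨u, Ψ u⟩

/-- `Ψ` is a jet field, i.e. a smooth section of `π¹`. -/
def IsSmoothJetField (Ψ : ∀ u : E, JetFiber m n π u) : Prop :=
  ContMDiff 𝓘(ℝ, RSpace (m + n)) 𝓘(ℝ, JetModel m n) ∞ (jetLift Ψ)

/-- The jet field `Ψ` is integrable: through every point there is a local section `γ` of `π` with
`j¹γ = Ψ ∘ γ`. -/
def IsIntegrableJetField (Ψ : ∀ u : E, JetFiber m n π u) : Prop :=
  ∀ u : E, ∃ (U : Set M) (γ : M → E), IsLocalSection (m := m) (H := RSpace (m + n)) π U γ ∧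
    π u ∈ U ∧ γ (π u) = u ∧ ∀ x ∈ U, IsJetAt γ x (Ψ (γ x))

/-- The distribution `Tπ¹(D|_{Im Ψ})` in `E`. -/
def jetProjected (D : ∀ j : Jet m n π, Submodule ℝ (TangentSpace 𝓘(ℝ, JetModel m n) j))
    (Ψ : ∀ u : E, JetFiber m n π u) (u : E) :
    Submodule ℝ (TangentSpace 𝓘(ℝ, RSpace (m + n)) u) :=
  (D ⟨u, Ψ u⟩).map (tangentJetProj (⟨u, Ψ u⟩ : Jet m n π)).toLinearMap

/-- `Ψ` is a solution of the generalized Lagrangian Hamilton–Jacobi problem for `D = D_𝓛`: it is an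
integrable jet field and, for every integral section `γ` of `Tπ¹(D|_{Im Ψ})`, the section `Ψ ∘ γ` is
an integral section of `D`. (That `Tπ¹(D|_{Im Ψ})` is an integrable distribution of rank `m` is
automatic: as integral sections of `D_𝓛` are holonomic, it is the one defined by `Ψ`.) -/
structure SolvesGeneralizedLagrangianHJ
    (D : ∀ j : Jet m n π, Submodule ℝ (TangentSpace 𝓘(ℝ, JetModel m n) j))
    (Ψ : ∀ u : E, JetFiber m n π u) : Prop where
  isSmooth : IsSmoothJetField Ψ
  isIntegrable : IsIntegrableJetField Ψ
  lifts : ∀ (U : Set M) (γ : M → E), IsIntegralSection (m := m) π (jetProjected D Ψ) U γ →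
    IsIntegralSection (m := m) jetBase D U (jetLift Ψ ∘ γ)

end Lagrangian

section Hamiltonian

variable [IsManifold 𝓘(ℝ, RSpace m) ∞ M] [IsManifold 𝓘(ℝ, RSpace (m + n)) ∞ E]
  {π : E → M} [FiberedManifold m n π]

/-- The projection `π_E^r : J¹π* → E`. -/
def dualProj (q : DualJet m n π) : E := q.pt

/-- The tangent map `T_qπ_E^r`. -/
def tangentDualProj (q : DualJet m n π) :
    TangentSpace 𝓘(ℝ, DualJetModel m n) q →L[ℝ] TangentSpace 𝓘(ℝ, RSpace (m + n)) q.pt :=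
  mfderiv 𝓘(ℝ, DualJetModel m n) 𝓘(ℝ, RSpace (m + n)) (dualProj : DualJet m n π → E) q

/-- The projection `π̄_E^r : J¹π* → M`. -/
def dualBase (q : DualJet m n π) : M := π q.pt

variable (m n π) in
/-- A Hamiltonian section, i.e. a smooth section `h` of `μ : Λ^m_2(T^*E) → J¹π^*`: a choice of
a representative `h q ∈ Λ^m_2(T^*_u E)` of each class `q` over `u`, such that in adapted coordinates
the function `-H(q) = h(q)(∂/∂x^1, …, ∂/∂x^m)` is smooth. -/
structure HamiltonianSection where
  form : ∀ q : DualJet m n π,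
    verticalForms (mfderiv 𝓘(ℝ, RSpace (m + n)) 𝓘(ℝ, RSpace m) π q.pt) m 2
  isSection : ∀ q : DualJet m n π,
    reducedClass (mfderiv 𝓘(ℝ, RSpace (m + n)) 𝓘(ℝ, RSpace m) π q.pt) m (form q) = q.cls
  smooth : ∀ a : AdaptedChart m n π,
    ContMDiffOn 𝓘(ℝ, DualJetModel m n) 𝓘(ℝ, ℝ) ∞
      (fun q : DualJet m n π => (form q).1 (fun i =>
        chartDinv (RSpace (m + n)) a.tot q.pt (EuclideanSpace.single i 1, 0)))
      {q | q.pt ∈ a.tot.source}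

/-- The Hamilton–Cartan `m`-form `Θ_h = h^*Θ`, where `Θ` is the tautological form of `Λ^m_2(T^*E)`,
i.e. `Θ_h(q) = (π_E^r)^*(h q)`. -/
def hamiltonCartanForm (h : HamiltonianSection m n π) (q : DualJet m n π) :
    TangentSpace 𝓘(ℝ, DualJetModel m n) q [⋀^Fin m]→L[ℝ] ℝ :=
  (h.form q).1.compContinuousLinearMap (tangentDualProj q)

/-- The Hamilton–Cartan `(m+1)`-form `Ω_h = h^*Ω = -dΘ_h`. -/
def hamiltonMultisymplecticForm (h : HamiltonianSection m n π) (q : DualJet m n π) :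
    TangentSpace 𝓘(ℝ, DualJetModel m n) q [⋀^Fin (m + 1)]→L[ℝ] ℝ :=
  -exteriorDerivative (hamiltonCartanForm h) q

/-- `D` is a solution of the Hamiltonian problem of the Hamiltonian section `h`: an `m`-dimensional,
`π̄_E^r`-transverse and integrable distribution in `J¹π*` whose integral sections satisfy
`ψ^* i(X)Ω_h = 0` for every vector field `X` on `J¹π*`. -/
structure SolvesHamiltonianProblem (h : HamiltonianSection m n π)
    (D : ∀ q : DualJet m n π, Submodule ℝ (TangentSpace 𝓘(ℝ, DualJetModel m n) q)) : Prop where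
  isSmooth : IsSmoothDistribution m D
  isTransverse : IsTransverse (m := m) (dualBase : DualJet m n π → M) D
  isIntegrable : IsIntegrable (m := m) (dualBase : DualJet m n π → M) D
  fieldEquation : ∀ (U : Set M) (ψ : M → DualJet m n π), IsIntegralSection (m := m) dualBase D U ψ →
    SolvesFieldEquation (hamiltonMultisymplecticForm h) U ψ

/-- The section `u ↦ (u, s u)` of `π_E^r : J¹π* → E` given by a field of reduced forms. -/
def dualLift (s : ∀ u : E, ReducedForms (mfderiv 𝓘(ℝ, RSpace (m + n)) 𝓘(ℝ, RSpace m) π u) m)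
    (u : E) : DualJet m n π := ⟨u, s u⟩

/-- The distribution `Tπ_E^r(D|_{Im s})` in `E`. -/
def dualProjected (D : ∀ q : DualJet m n π, Submodule ℝ (TangentSpace 𝓘(ℝ, DualJetModel m n) q))
    (s : ∀ u : E, ReducedForms (mfderiv 𝓘(ℝ, RSpace (m + n)) 𝓘(ℝ, RSpace m) π u) m) (u : E) :
    Submodule ℝ (TangentSpace 𝓘(ℝ, RSpace (m + n)) u) :=
  (D ⟨u, s u⟩).map (tangentDualProj (⟨u, s u⟩ : DualJet m n π)).toLinearMap

/-- `s` is a solution of the generalized Hamiltonian Hamilton–Jacobi problem for `D = D_h`: it is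
a smooth section of `π_E^r` for which `Tπ_E^r(D|_{Im s})` is integrable and, for every integral
section `γ` of this distribution, `s ∘ γ` is an integral section of `D`. -/
structure SolvesGeneralizedHamiltonianHJ
    (D : ∀ q : DualJet m n π, Submodule ℝ (TangentSpace 𝓘(ℝ, DualJetModel m n) q))
    (s : ∀ u : E, ReducedForms (mfderiv 𝓘(ℝ, RSpace (m + n)) 𝓘(ℝ, RSpace m) π u) m) : Prop where
  isSmooth : ContMDiff 𝓘(ℝ, RSpace (m + n)) 𝓘(ℝ, DualJetModel m n) ∞ (dualLift s)
  isIntegrable : IsIntegrable (m := m) π (dualProjected D s)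
  lifts : ∀ (U : Set M) (γ : M → E), IsIntegralSection (m := m) π (dualProjected D s) U γ →
    IsIntegralSection (m := m) dualBase D U (dualLift s ∘ γ)

end Hamiltonian
end FieldTheory
end

/-! Both cases are instances of one statement, `IsIntegralSection.proj_of_boundaryConditions`. Let
`D` be a rank `m` distribution on `N`, transverse to `ρ = π ∘ pr`, and let `σ` be a section of `pr :
N → E` that lifts the integral sections of the projected distribution `D'` to integral sections of
`D`. Then the image `S` of `σ` is closed, and an integral section of `D` lying in `S` passes through
each of its points: lift an integral section of `D'`. The claim reduces to uniqueness: an integral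
section of `D` over a connected set, with boundary conditions in `S`, never leaves `S`. Once `ψ`
takes values in `S`, the chain rule shows that `pr ∘ ψ` is tangent to `D'`. The converse is
immediate, since `σ ∘ γ` projects to `γ`.

Uniqueness is an ODE argument along coordinate lines of the base. By transversality and rank, a
constant vector `v` in a chart of `M` has at most one lift to `D` at each point, and nearby these
lifts are values of a `C^1` vector field (`IsSmoothDistribution.exists_lift`). An integral section
restricted to a line of direction `v` is therefore an integral curve of that field, so two integral
sections with a common initial value agree on a short segment (`IsIntegralSection.eventually_eq`).
Membership in `S` thus propagates along segments in charts, hence over the connected set `U`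
(`IsFoliated.mapsTo`).

For data on the boundary, only one-sided information is available. `eventually_eq_of_hasDerivAt`
starts the curves at an endpoint where they are merely continuous, and
`IsFoliated.exists_mem_of_boundaryConditions` applies this at the last point outside `U` of a
segment ending in `U`, so that `ψ` meets `S` inside `U`.

In the Lagrangian case the integrability of `D'` has to be derived: holonomy identifies `D'` with
the distribution of the integrable jet field `Ψ`. In the Hamiltonian case it is part of the
definition of a solution. -/

set_option linter.unusedSectionVars false
noncomputable section
namespace FieldTheory

/-! ### Lifts of constant vectors and one-sided uniqueness for ODEs in a normed space -/

section VectorSpace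

variable {H : Type*} [NormedAddCommGroup H] [NormedSpace ℝ H] {k : ℕ}

/-- If `R` maps the span of the vector fields `Z i` isomorphically onto `ℝ^k` at `z₀`, then the lifts
of a constant vector `v` to this span are, near `z₀`, the values of a `C^1` vector field. -/
lemma exists_lift_vectorField {Z : Fin k → H → H} {R : H → RSpace k} {z₀ : H}
    (hZ : ∀ i, ContDiffAt ℝ 1 (Z i) z₀) (hR : ContDiffAt ℝ 2 R z₀)
    (hinj : ∀ a : RSpace k, fderiv ℝ R z₀ (∑ i, a i • Z i z₀) = 0 → a = 0) (v : RSpace k) :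
    ∃ F : H → H, ContDiffAt ℝ 1 F z₀ ∧ ∀ᶠ z in 𝓝 z₀,
      ∀ w ∈ Submodule.span ℝ (range fun i => Z i z), fderiv ℝ R z w = v → w = F z := by
  -- `T z` parametrizes the span by `ℝ^k`, and the lift of `v` will be `T z ((G z)⁻¹ v)` with `G =
  -- DR ∘ T`. Only an endomorphism of `ℝ^k` is inverted, so `H` needs neither completeness nor
  -- finite dimension.
  let T : H → RSpace k →L[ℝ] H := fun z =>
    ∑ i, (EuclideanSpace.proj i : RSpace k →L[ℝ] ℝ).smulRight (Z i z)
  have hT : ∀ z a, T z a = ∑ i, a i • Z i z := fun z a => by simp [T]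
  let G : H → RSpace k →L[ℝ] RSpace k := fun z => (fderiv ℝ R z).comp (T z)
  have cT : ContDiffAt ℝ 1 T z₀ := by
    refine ContDiffAt.sum fun i _ => ?_
    exact (ContinuousLinearMap.smulRightL ℝ (RSpace k) H
      (EuclideanSpace.proj i : RSpace k →L[ℝ] ℝ)).contDiff.contDiffAt.comp z₀ (hZ i)
  -- Class `C^2` of `R` leaves its derivative `C^1`, which is what the Lipschitz estimate for the
  -- ODE will use.
  have cG : ContDiffAt ℝ 1 G z₀ := (hR.fderiv_right (m := 1) (by norm_num)).clm_comp cT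
  have hbij : Function.Bijective (G z₀) := by
    have hi : Function.Injective (G z₀ : RSpace k →ₗ[ℝ] RSpace k) :=
      (injective_iff_map_eq_zero _).2 fun a ha => hinj a (by rw [← hT]; exact ha)
    exact ⟨hi, LinearMap.injective_iff_surjective.1 hi⟩
  obtain ⟨e₀, he₀⟩ : ∃ e₀ : RSpace k ≃L[ℝ] RSpace k, (e₀ : RSpace k →L[ℝ] RSpace k) = G z₀ :=
    ⟨ContinuousLinearEquiv.ofBijective (G z₀) (LinearMap.ker_eq_bot.2 hbij.1)
      (LinearMap.range_eq_top.2 hbij.2), ContinuousLinearEquiv.coe_ofBijective _ _ _⟩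
  have cI : ContDiffAt ℝ 1 (fun z => (G z).inverse) z₀ := by
    have := contDiffAt_map_inverse (𝕜 := ℝ) (n := 1) e₀
    rw [he₀] at this
    exact this.comp z₀ cG
  refine ⟨fun z => T z ((G z).inverse v), cT.clm_apply (cI.clm_apply contDiffAt_const), ?_⟩
  -- Invertible maps form an open set. Where `G z` is invertible, a vector `T z c` of the span
  -- lifting `v` satisfies `G z c = v`, which determines `c`.
  have hev : ∀ᶠ z in 𝓝 z₀, G z ∈ range ((↑) : (RSpace k ≃L[ℝ] RSpace k) → _) :=
    cG.continuousAt.eventually_mem (he₀ ▸ ContinuousLinearEquiv.nhds e₀)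
  filter_upwards [hev] with z ⟨e, he⟩ w hw hv
  obtain ⟨c, rfl⟩ := (Submodule.mem_span_range_iff_exists_fun ℝ).1 hw
  have hc : T z (WithLp.toLp 2 c) = ∑ i, c i • Z i z := hT z _
  have hG : e (WithLp.toLp 2 c) = v := by
    rw [← hv, ← hc]; exact DFunLike.congr_fun he _
  rw [← hc]
  refine congrArg (T z) ?_
  rw [← he, ContinuousLinearMap.inverse_equiv, ← hG]
  exact (e.symm_apply_apply _).symm

/-- A `C^1` field is locally Lipschitz, so Grönwall applies on a short interval `[0, b]`. The
equation is assumed only for `t > 0`, with right continuity at `0`, because a section with boundary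
data is not differentiable, or even defined nearby, at its boundary point. -/
lemma eventually_eq_of_hasDerivAt {F : H → H} {f g : ℝ → H} (hF : ContDiffAt ℝ 1 F (f 0))
    (hf : ContinuousWithinAt f (Ioi 0) 0) (hg : ContinuousWithinAt g (Ioi 0) 0) (h0 : f 0 = g 0)
    (hf' : ∀ᶠ t in 𝓝[>] 0, HasDerivAt f (F (f t)) t)
    (hg' : ∀ᶠ t in 𝓝[>] 0, HasDerivAt g (F (g t)) t) :
    ∀ᶠ t in 𝓝[>] (0 : ℝ), f t = g t := by
  obtain ⟨K, s, hs, hK⟩ := hF.exists_lipschitzOnWith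
  have key : ∀ {f : ℝ → H}, ContDiffAt ℝ 1 F (f 0) → s ∈ 𝓝 (f 0) →
      ContinuousWithinAt f (Ioi 0) 0 → (∀ᶠ t in 𝓝[>] 0, HasDerivAt f (F (f t)) t) →
      ∀ᶠ b in 𝓝[>] (0 : ℝ), ContinuousOn f (Icc 0 b) ∧
        (∀ t ∈ Ico 0 b, HasDerivWithinAt f (F (f t)) (Ici t) t) ∧ ∀ t ∈ Ico 0 b, f t ∈ s := by
    intro f hF hs hf hf'
    obtain ⟨c, hc, hcs⟩ := mem_nhdsGT_iff_exists_Ioo_subset.1 (hf'.and (hf.eventually_mem hs))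
    have hc' : (0 : ℝ) < c := hc
    -- The equation extends to the endpoint: the derivatives `F (f t)` tend to `F (f 0)`, and a
    -- curve continuous at `0` whose derivative has a limit there has that limit as right
    -- derivative.
    have hd0 : HasDerivWithinAt f (F (f 0)) (Ici 0) 0 := by
      refine hasDerivWithinAt_Ici_of_tendsto_deriv (s := Ioo 0 c)
        (fun t ht => (hcs ht).1.differentiableAt.differentiableWithinAt)
        (hf.mono Ioo_subset_Ioi_self) (Ioo_mem_nhdsGT hc') ?_
      refine (hF.continuousAt.tendsto.comp hf).congr' ?_
      filter_upwards [hf'] with t ht using ht.deriv.symm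
    filter_upwards [Ioo_mem_nhdsGT hc'] with b hb
    refine ⟨fun t ht => ?_, fun t ht => ?_, fun t ht => ?_⟩ <;>
      rcases ht.1.eq_or_lt with rfl | ht0
    · exact hd0.continuousWithinAt.mono Icc_subset_Ici_self
    · exact (hcs ⟨ht0, ht.2.trans_lt hb.2⟩).1.continuousAt.continuousWithinAt
    · exact hd0
    · exact (hcs ⟨ht0, ht.2.trans hb.2⟩).1.hasDerivWithinAt
    · exact mem_of_mem_nhds hs
    · exact (hcs ⟨ht0, ht.2.trans hb.2⟩).2
  obtain ⟨b, ⟨⟨c1, d1, m1⟩, c2, d2, m2⟩, hb⟩ := (((key hF hs hf hf').and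
    (key (h0 ▸ hF) (h0 ▸ hs) hg hg')).and self_mem_nhdsWithin).exists
  have := ODE_solution_unique_of_mem_Icc_right (v := fun _ => F) (s := fun _ => s) (K := K)
    (fun _ _ => hK) c1 d1 m1 c2 d2 m2 h0
  filter_upwards [Ioo_mem_nhdsGT hb] with t ht using this ⟨ht.1.le, ht.2.le⟩

end VectorSpace

/-! ### Vector fields in charts -/

section Charts

variable {H : Type*} [NormedAddCommGroup H] [NormedSpace ℝ H]
  {N : Type*} [TopologicalSpace N] [ChartedSpace H N] [IsManifold 𝓘(ℝ, H) ∞ N]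

lemma isSmoothChart_chartAt (p : N) : IsSmoothChart H (chartAt H p) :=
  ⟨contMDiffOn_chart, contMDiffOn_chart_symm⟩

/-- The components of a smooth vector field in a chart are smooth. -/
lemma IsSmoothVectorFieldOn.contDiffOn_chart {e : OpenPartialHomeomorph N H}
    (he : IsSmoothChart H e) {X : ∀ p : N, TangentSpace 𝓘(ℝ, H) p} {V : Set N}
    (hX : IsSmoothVectorFieldOn X V) :
    ContDiffOn ℝ 1 (fun z => (chartD H e (e.symm z) (X (e.symm z)) : H))
      (e.target ∩ e.symm ⁻¹' V) := by
  have : IsManifold 𝓘(ℝ, H) 1 N := IsManifold.of_le (n := ∞) (by exact_mod_cast le_top)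
  -- The components are read off from the tangent map of the chart composed with the field; passing
  -- to the tangent map costs one derivative.
  have h1 := he.smooth.contMDiffOn_tangentMapWithin (m := 1) (WithTop.coe_le_coe.2 (le_top : (2 : ℕ∞) ≤ ⊤))
    e.open_source.uniqueMDiffOn
  have h2 : ContMDiffOn 𝓘(ℝ, H) 𝓘(ℝ, H).tangent 1
      (fun z => (⟨e.symm z, X (e.symm z)⟩ : TangentBundle 𝓘(ℝ, H) N))
      (e.target ∩ e.symm ⁻¹' V) :=
    (hX.of_le (by simp)).comp ((he.smooth_symm.of_le (by simp)).mono inter_subset_left)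
      inter_subset_right
  have h3 := h1.comp h2 fun z hz => e.map_target hz.1
  refine contMDiffOn_vectorSpace_iff_contDiffOn.1 (h3.congr fun z hz => ?_)
  have hs : e.symm z ∈ e.source := e.map_target hz.1
  -- The base points `e (e.symm z)` and `z` are equal but not definitionally so. The tangent bundle
  -- of `H` has constant fibre, which lets the vector be carried over unchanged.
  have hpt : ∀ (a y w : H), a = y → (⟨y, w⟩ : TangentBundle 𝓘(ℝ, H) H) = ⟨a, w⟩ := by
    rintro _ _ _ rfl; rfl
  have hd : mfderivWithin 𝓘(ℝ, H) 𝓘(ℝ, H) e e.source (e.symm z) = chartD H e (e.symm z) :=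
    mfderivWithin_of_isOpen e.open_source hs
  exact (hpt _ _ _ (e.right_inv hz.1)).trans
    (congrArg (fun L : TangentSpace 𝓘(ℝ, H) (e.symm z) →L[ℝ] H =>
      (⟨e (e.symm z), L (X (e.symm z))⟩ : TangentBundle 𝓘(ℝ, H) H)) hd.symm)

end Charts

/-! ### Integral sections along coordinate lines as integral curves -/

section Lifts

variable {m : ℕ} {M : Type*} [TopologicalSpace M] [ChartedSpace (RSpace m) M]
  [IsManifold 𝓘(ℝ, RSpace m) ∞ M]
  {H : Type*} [NormedAddCommGroup H] [NormedSpace ℝ H]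
  {N : Type*} [TopologicalSpace N] [ChartedSpace H N] [IsManifold 𝓘(ℝ, H) ∞ N]
  {ρ : N → M} {D : ∀ p : N, Submodule ℝ (TangentSpace 𝓘(ℝ, H) p)}
  {e : OpenPartialHomeomorph N H} {b : OpenPartialHomeomorph M (RSpace m)}

/-- The lifts to a transverse distribution of a coordinate vector field of the base are given, in
coordinates, by a `C^1` vector field. -/
lemma IsSmoothDistribution.exists_lift (hD : IsSmoothDistribution m D)
    (hρ : ContMDiff 𝓘(ℝ, H) 𝓘(ℝ, RSpace m) ∞ ρ) (hT : IsTransverse (m := m) ρ D)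
    (he : IsSmoothChart H e) (hb : IsSmoothChart (RSpace m) b) {q : N} (hq : q ∈ e.source)
    (hqb : ρ q ∈ b.source) (v : RSpace m) :
    ∃ F : H → H, ContDiffAt ℝ 1 F (e q) ∧ ∀ᶠ p in 𝓝 q, ∀ w ∈ D p,
      chartD (RSpace m) b (ρ p) (mfderiv 𝓘(ℝ, H) 𝓘(ℝ, RSpace m) ρ p w) = v →
        chartD H e p w = F (e p) := by
  obtain ⟨V, hVo, hqV, Z, hZ, hspan⟩ := hD q
  let O : Set N := e.source ∩ ρ ⁻¹' b.source ∩ V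
  have hOo : IsOpen O := (e.open_source.inter (b.open_source.preimage hρ.continuous)).inter hVo
  have hqO : q ∈ O := ⟨⟨hq, hqb⟩, hqV⟩
  have hR : ContDiffOn ℝ ∞ (b ∘ ρ ∘ e.symm) (e.target ∩ e.symm ⁻¹' (ρ ⁻¹' b.source)) := by
    rw [← contMDiffOn_iff_contDiffOn]
    exact hb.smooth.comp (hρ.comp_contMDiffOn (he.smooth_symm.mono inter_subset_left))
      inter_subset_right
  have hRo : IsOpen (e.target ∩ e.symm ⁻¹' (ρ ⁻¹' b.source)) :=
    e.symm.isOpen_inter_preimage (b.open_source.preimage hρ.continuous)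
  have hmemR : ∀ p ∈ O, e p ∈ e.target ∩ e.symm ⁻¹' (ρ ⁻¹' b.source) := fun p hp =>
    ⟨e.map_source hp.1.1, by
      change ρ (e.symm (e p)) ∈ b.source
      rw [e.left_inv hp.1.1]; exact hp.1.2⟩
  -- The chain rule `D(b ∘ ρ ∘ e⁻¹) ∘ De = Db ∘ Tρ` on `O` translates lifts on the manifold into
  -- lifts in coordinates.
  have hfd : ∀ p ∈ O, ∀ w : TangentSpace 𝓘(ℝ, H) p,
      fderiv ℝ (b ∘ ρ ∘ e.symm) (e p) (chartD H e p w) =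
        chartD (RSpace m) b (ρ p) (mfderiv 𝓘(ℝ, H) 𝓘(ℝ, RSpace m) ρ p w) := by
    intro p hp w
    have d1 : MDifferentiableAt 𝓘(ℝ, H) 𝓘(ℝ, RSpace m) (b ∘ ρ ∘ e.symm) (e p) :=
      ((hR.differentiableOn (by simp)).differentiableAt
        (hRo.mem_nhds (hmemR p hp))).mdifferentiableAt
    have d2 := mfderiv_comp_apply (I' := 𝓘(ℝ, H)) p d1 (he.mdiff.mdifferentiableAt hp.1.1) w
    have d3 := mfderiv_comp_apply (I' := 𝓘(ℝ, RSpace m)) p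
      (hb.mdiff.mdifferentiableAt hp.1.2) (hρ.mdifferentiableAt (by simp)) w
    have d4 : mfderiv 𝓘(ℝ, H) 𝓘(ℝ, RSpace m) ((b ∘ ρ ∘ e.symm) ∘ e) p =
        mfderiv 𝓘(ℝ, H) 𝓘(ℝ, RSpace m) (b ∘ ρ) p := by
      apply Filter.EventuallyEq.mfderiv_eq
      filter_upwards [e.open_source.mem_nhds hp.1.1] with y hy
      simp [e.left_inv hy]
    rw [mfderiv_eq_fderiv] at d2
    exact d2.symm.trans ((DFunLike.congr_fun d4 w).trans d3)
  have hZe : ∀ p ∈ O, ∀ i, (chartD H e (e.symm (e p)) (Z i (e.symm (e p))) : H) =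
      chartD H e p (Z i p) := by
    intro p hp i
    rw [e.left_inv hp.1.1]
  obtain ⟨F, hF, hFe⟩ := exists_lift_vectorField (z₀ := e q) (v := v)
    (Z := fun i z => chartD H e (e.symm z) (Z i (e.symm z))) (R := b ∘ ρ ∘ e.symm)
    (fun i => ((hZ i).contDiffOn_chart he).contDiffAt
      ((e.symm.isOpen_inter_preimage hVo).mem_nhds
        ⟨e.map_source hq, by change e.symm (e q) ∈ V; rwa [e.left_inv hq]⟩))
    ((hR.contDiffAt (hRo.mem_nhds (hmemR q hqO))).of_le (WithTop.coe_le_coe.2 (le_top : (2 : ℕ∞) ≤ ⊤))) (by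
      -- A combination of the frame killed in coordinates is `ρ`-vertical because `Db` is injective.
      -- Transversality makes it zero, and linear independence of the frame makes its coefficients
      -- zero.
      intro a ha
      simp only [hZe q hqO] at ha
      have hsum : (∑ i, a i • (chartD H e q (Z i q) : H)) =
          chartD H e q (∑ i, a i • Z i q) := by
        rw [map_sum]; simp only [map_smul]
      rw [hsum, hfd q hqO] at ha
      obtain ⟨f, hf⟩ := hb.exists_equiv hqb
      have h0 : mfderiv 𝓘(ℝ, H) 𝓘(ℝ, RSpace m) ρ q (∑ i, a i • Z i q) = 0 := by
        rw [hf] at ha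
        exact f.map_eq_zero_iff.1 ha
      have h1 := hT q _ (by
        rw [← (hspan q hqV).2]
        exact Submodule.sum_mem _ fun i _ => Submodule.smul_mem _ _
          (Submodule.subset_span ⟨i, rfl⟩)) h0
      ext i
      exact Fintype.linearIndependent_iff.1 (hspan q hqV).1 (fun i => a i) h1 i)
  refine ⟨F, hF, ?_⟩
  filter_upwards [(e.continuousAt hq).eventually hFe, hOo.mem_nhds hqO] with p hp hpO w hw hv
  refine hp _ ?_ (by rw [hfd p hpO]; exact hv)
  simp only [hZe p hpO]
  rw [← (hspan p hpO.2).2] at hw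
  have := Submodule.mem_map_of_mem (f := (chartD H e p).toLinearMap) hw
  rw [Submodule.map_span, ← range_comp] at this
  exact this

/-- The lift of a coordinate line to an integral section is tangent to the distribution. -/
lemma IsIntegralSection.exists_hasDerivAt (hρ : ContMDiff 𝓘(ℝ, H) 𝓘(ℝ, RSpace m) ∞ ρ)
    (he : IsSmoothChart H e) (hb : IsSmoothChart (RSpace m) b) {U : Set M} {ψ : M → N}
    (hψ : IsIntegralSection (m := m) ρ D U ψ) {z v : RSpace m} {t : ℝ} (hz : z + t • v ∈ b.target)
    (hU : b.symm (z + t • v) ∈ U) (hs : ψ (b.symm (z + t • v)) ∈ e.source) :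
    ∃ w ∈ D (ψ (b.symm (z + t • v))),
      chartD (RSpace m) b (ρ (ψ (b.symm (z + t • v))))
        (mfderiv 𝓘(ℝ, H) 𝓘(ℝ, RSpace m) ρ (ψ (b.symm (z + t • v))) w) = v ∧
      HasDerivAt (fun s : ℝ => e (ψ (b.symm (z + s • v))))
        (chartD H e (ψ (b.symm (z + t • v))) w) t := by
  set y := z + t • v with hy
  set x := b.symm y with hx
  have hxb : x ∈ b.source := b.map_target hz
  have d1 : HasMFDerivAt 𝓘(ℝ, RSpace m) 𝓘(ℝ, RSpace m) b.symm y
      (mfderiv 𝓘(ℝ, RSpace m) 𝓘(ℝ, RSpace m) b.symm y) :=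
    (hb.mdiff.symm.mdifferentiableAt hz).hasMFDerivAt
  have d2 : HasMFDerivAt 𝓘(ℝ, RSpace m) 𝓘(ℝ, H) ψ x (mfderiv 𝓘(ℝ, RSpace m) 𝓘(ℝ, H) ψ x) :=
    ((hψ.smooth.contMDiffAt (hψ.isOpen.mem_nhds hU)).mdifferentiableAt (by simp)).hasMFDerivAt
  have d3 : HasMFDerivAt 𝓘(ℝ, H) 𝓘(ℝ, H) e (ψ x) (chartD H e (ψ x)) :=
    (he.mdiff.mdifferentiableAt hs).hasMFDerivAt
  have d4 : HasMFDerivAt 𝓘(ℝ, H) 𝓘(ℝ, RSpace m) ρ (ψ x) (mfderiv 𝓘(ℝ, H) 𝓘(ℝ, RSpace m) ρ (ψ x)) :=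
    (hρ.mdifferentiableAt (by simp)).hasMFDerivAt
  have hρψ : ρ (ψ x) = x := hψ.right_inv x hU
  have d5 : HasMFDerivAt 𝓘(ℝ, RSpace m) 𝓘(ℝ, RSpace m) b (ρ (ψ x))
      (chartD (RSpace m) b (ρ (ψ x))) :=
    (hb.mdiff.mdifferentiableAt (hρψ.symm ▸ hxb)).hasMFDerivAt
  have c1 := d2.comp y d1
  have c2 := d3.comp y c1
  have c3 := d5.comp y (d4.comp y c1)
  -- As `ψ` is a section, the composite derivative `c3` is that of the identity; this is the
  -- required equation for the projection of `w`.
  have hid : (b ∘ ρ ∘ ψ ∘ b.symm) =ᶠ[𝓝 y] id := by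
    have hcont : ContinuousAt b.symm y := b.symm.continuousAt hz
    filter_upwards [b.open_target.mem_nhds hz, hcont.eventually_mem (hψ.isOpen.mem_nhds hU)]
      with y' h1 h2
    simp [hψ.right_inv _ h2, b.right_inv h1]
  have c4 := (hasMFDerivAt_id (I := 𝓘(ℝ, RSpace m)) y).congr_of_eventuallyEq hid
  have c5 := hasMFDerivAt_unique c3 c4
  -- The vector `w` is the image of `v` under the tangent maps of `b⁻¹` and `ψ`, hence in `D` by
  -- tangency.
  refine ⟨mfderiv 𝓘(ℝ, RSpace m) 𝓘(ℝ, H) ψ x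
    (mfderiv 𝓘(ℝ, RSpace m) 𝓘(ℝ, RSpace m) b.symm y v), ?_, DFunLike.congr_fun c5 v, ?_⟩
  · rw [← hψ.tangent x hU]
    exact ⟨_, rfl⟩
  · have hl : HasDerivAt (fun s : ℝ => z + s • v) v t := by
      simpa using ((hasDerivAt_id t).smul_const v).const_add z
    exact (hasMFDerivAt_iff_hasFDerivAt.1 c2).comp_hasDerivAt t hl

/-- Two integral sections, one defined near `b⁻¹ z` and the other one on a segment issuing from this
point, which have the same value or limit there, agree on the segment near the point. -/
lemma IsIntegralSection.eventually_eq (hρ : ContMDiff 𝓘(ℝ, H) 𝓘(ℝ, RSpace m) ∞ ρ)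
    (hD : IsSmoothDistribution m D) (hT : IsTransverse (m := m) ρ D) (hb : IsSmoothChart (RSpace m) b)
    {U W : Set M} {ψ χ : M → N} (hψ : IsIntegralSection (m := m) ρ D U ψ) (hχ : IsIntegralSection (m := m) ρ D W χ)
    {z v : RSpace m} (hz : z ∈ b.target) (hW : b.symm z ∈ W)
    (hU : ∀ᶠ t in 𝓝[>] (0 : ℝ), b.symm (z + t • v) ∈ U)
    (hc : ContinuousWithinAt (fun t : ℝ => ψ (b.symm (z + t • v))) (Ioi 0) 0)
    (h0 : ψ (b.symm z) = χ (b.symm z)) :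
    ∀ᶠ t in 𝓝[>] (0 : ℝ), ψ (b.symm (z + t • v)) = χ (b.symm (z + t • v)) := by
  set q := χ (b.symm z) with hq
  set e := chartAt H q with he
  have hes : IsSmoothChart H e := isSmoothChart_chartAt q
  have hqe : q ∈ e.source := mem_chart_source H q
  have hρq : ρ q = b.symm z := hχ.right_inv _ hW
  obtain ⟨F, hF, hev⟩ := hD.exists_lift hρ hT hes hb hqe (hρq ▸ b.map_target hz) v
  have hl : Continuous fun t : ℝ => z + t • v := by fun_prop
  have hl0 : z + (0 : ℝ) • v = z := by simp
  have htar : ∀ᶠ t in 𝓝[>] (0 : ℝ), z + t • v ∈ b.target :=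
    nhdsWithin_le_nhds (hl.continuousAt.eventually_mem (by
      rw [hl0]; exact b.open_target.mem_nhds hz))
  have hbl : ContinuousAt (fun t : ℝ => b.symm (z + t • v)) 0 := by
    refine ContinuousAt.comp (g := b.symm) ?_ hl.continuousAt
    rw [hl0]; exact b.symm.continuousAt hz
  have hW' : ∀ᶠ t in 𝓝[>] (0 : ℝ), b.symm (z + t • v) ∈ W :=
    nhdsWithin_le_nhds (hbl.eventually_mem (by rw [hl0]; exact hχ.isOpen.mem_nhds hW))
  have hcχ : ContinuousWithinAt (fun t : ℝ => χ (b.symm (z + t • v))) (Ioi 0) 0 := by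
    refine ContinuousAt.continuousWithinAt (ContinuousAt.comp (g := χ) ?_ hbl)
    rw [hl0]
    exact (hχ.smooth.continuousOn.continuousAt (hχ.isOpen.mem_nhds hW))
  -- Applied to both sections: near the common value `q`, each is read in the chart `e` as a
  -- solution of the same equation with field `F`. The initial base point is not required to lie in
  -- the domain of the section.
  have key : ∀ {U : Set M} {ψ : M → N}, IsIntegralSection (m := m) ρ D U ψ → ψ (b.symm z) = q →
      (∀ᶠ t in 𝓝[>] (0 : ℝ), b.symm (z + t • v) ∈ U) →
      ContinuousWithinAt (fun t : ℝ => ψ (b.symm (z + t • v))) (Ioi 0) 0 →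
      (∀ᶠ t in 𝓝[>] (0 : ℝ), ψ (b.symm (z + t • v)) ∈ e.source) ∧
      ContinuousWithinAt (fun t : ℝ => e (ψ (b.symm (z + t • v)))) (Ioi 0) 0 ∧
      ∀ᶠ t in 𝓝[>] (0 : ℝ), HasDerivAt (fun t : ℝ => e (ψ (b.symm (z + t • v))))
        (F (e (ψ (b.symm (z + t • v))))) t := by
    intro U ψ hψ h0 hU hc
    have hc' : Filter.Tendsto (fun t : ℝ => ψ (b.symm (z + t • v))) (𝓝[>] 0) (𝓝 q) := by
      have h := hc.tendsto
      rwa [hl0, h0] at h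
    have hs : ∀ᶠ t in 𝓝[>] (0 : ℝ), ψ (b.symm (z + t • v)) ∈ e.source :=
      hc'.eventually_mem (e.open_source.mem_nhds hqe)
    refine ⟨hs, ContinuousAt.comp_continuousWithinAt (g := e) ?_ hc, ?_⟩
    · rw [hl0, h0]; exact e.continuousAt hqe
    · filter_upwards [hs, hU, htar, hc'.eventually hev] with t h1 h2 h3 h4
      obtain ⟨w, hw, hv, hd⟩ := hψ.exists_hasDerivAt hρ hes hb h3 h2 h1
      rwa [h4 w hw hv] at hd
  obtain ⟨s1, c1, d1⟩ := key hψ h0 hU hc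
  obtain ⟨s2, c2, d2⟩ := key hχ rfl hW' hcχ
  have := eventually_eq_of_hasDerivAt (F := F) (by rw [hl0, h0]; exact hF) c1 c2
    (by rw [hl0, h0]) d1 d2
  filter_upwards [this, s1, s2] with t h1 h2 h3 using e.injOn h2 h3 h1

end Lifts

/-! ### Propagation of membership in a foliated set -/

section Propagation

variable {m : ℕ} {M : Type*} [TopologicalSpace M] [ChartedSpace (RSpace m) M]
  [IsManifold 𝓘(ℝ, RSpace m) ∞ M]
  {H : Type*} [NormedAddCommGroup H] [NormedSpace ℝ H]
  {N : Type*} [TopologicalSpace N] [ChartedSpace H N] [IsManifold 𝓘(ℝ, H) ∞ N]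
  {ρ : N → M} {D : ∀ p : N, Submodule ℝ (TangentSpace 𝓘(ℝ, H) p)}
  {b : OpenPartialHomeomorph M (RSpace m)} {S : Set N} {U : Set M} {ψ : M → N}

variable (m) in
/-- The set `S` contains an integral section of `D` through each of its points. -/
def IsFoliated (ρ : N → M) (D : ∀ p : N, Submodule ℝ (TangentSpace 𝓘(ℝ, H) p)) (S : Set N) : Prop :=
  ∀ q ∈ S, ∃ (W : Set M) (χ : M → N),
    ρ q ∈ W ∧ χ (ρ q) = q ∧ IsIntegralSection (m := m) ρ D W χ ∧ MapsTo χ W S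

/-- By uniqueness `ψ` follows the integral section inside `S` through its initial value. The initial
base point may lie outside `U`, where `ψ` is not known to be a section; hence the separate
hypothesis `hs`. -/
lemma IsFoliated.eventually_mem (hS : IsFoliated m ρ D S)
    (hρ : ContMDiff 𝓘(ℝ, H) 𝓘(ℝ, RSpace m) ∞ ρ)
    (hD : IsSmoothDistribution m D) (hT : IsTransverse (m := m) ρ D)
    (hb : IsSmoothChart (RSpace m) b) (hψ : IsIntegralSection (m := m) ρ D U ψ)
    {z v : RSpace m} (hz : z ∈ b.target)
    (hU : ∀ᶠ t in 𝓝[>] (0 : ℝ), b.symm (z + t • v) ∈ U)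
    (hc : ContinuousWithinAt (fun t : ℝ => ψ (b.symm (z + t • v))) (Ioi 0) 0)
    (h0 : ψ (b.symm z) ∈ S) (hs : ρ (ψ (b.symm z)) = b.symm z) :
    ∀ᶠ t in 𝓝[>] (0 : ℝ), ψ (b.symm (z + t • v)) ∈ S := by
  obtain ⟨W, χ, hW, hχ0, hχ, hχS⟩ := hS _ h0
  rw [hs] at hW hχ0
  have hl : ContinuousAt (fun t : ℝ => b.symm (z + t • v)) 0 := by
    refine ContinuousAt.comp (g := b.symm) ?_ (by fun_prop)
    rw [zero_smul, add_zero]; exact b.symm.continuousAt hz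
  have hW' : ∀ᶠ t in 𝓝[>] (0 : ℝ), b.symm (z + t • v) ∈ W :=
    nhdsWithin_le_nhds (hl.eventually_mem (by
      rw [zero_smul, add_zero]; exact hχ.isOpen.mem_nhds hW))
  filter_upwards [hψ.eventually_eq hρ hD hT hb hχ hz hW hU hc hχ0.symm, hW'] with t h1 h2
  rw [h1]; exact hχS h2

/-- An integral section over a preconnected set which meets a closed foliated set lies in it. -/
lemma IsFoliated.mapsTo (hS : IsFoliated m ρ D S) (hSc : IsClosed S)
    (hρ : ContMDiff 𝓘(ℝ, H) 𝓘(ℝ, RSpace m) ∞ ρ)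
    (hD : IsSmoothDistribution m D) (hT : IsTransverse (m := m) ρ D)
    (hU : IsPreconnected U) (hψ : IsIntegralSection (m := m) ρ D U ψ)
    (hne : ∃ x ∈ U, ψ x ∈ S) : MapsTo ψ U S := by
  have hcont := hψ.smooth.continuousOn
  -- The complement in `U` is open because `S` is closed, so this openness is the crux. Around `x₀`
  -- it is checked on a ball of a chart, along the radial segments.
  have hopen : IsOpen (U ∩ ψ ⁻¹' S) := by
    refine isOpen_iff_mem_nhds.2 fun x₀ ⟨hx₀, hx₀S⟩ => ?_
    set b := chartAt (RSpace m) x₀ with hb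
    have hbs : IsSmoothChart (RSpace m) b := isSmoothChart_chartAt x₀
    have hx₀b : x₀ ∈ b.source := mem_chart_source _ x₀
    obtain ⟨r, hr, hball⟩ := Metric.isOpen_iff.1 (b.symm.isOpen_inter_preimage hψ.isOpen) (b x₀)
      ⟨b.map_source hx₀b, by change b.symm (b x₀) ∈ U; rwa [b.left_inv hx₀b]⟩
    have hmem : ∀ z ∈ Metric.ball (b x₀) r, ψ (b.symm z) ∈ S := by
      intro z hz
      set v := z - b x₀ with hv
      have hseg : ∀ t ∈ Icc (0 : ℝ) 1, b x₀ + t • v ∈ Metric.ball (b x₀) r := fun t ht =>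
        (convex_ball _ _).add_smul_sub_mem (Metric.mem_ball_self hr) hz ht
      have hbc : ContinuousOn (fun t : ℝ => b.symm (b x₀ + t • v)) (Icc 0 1) :=
        b.symm.continuousOn.comp (by fun_prop) fun t ht => (hball (hseg t ht)).1
      have hfc : ContinuousOn (fun t : ℝ => ψ (b.symm (b x₀ + t • v))) (Icc 0 1) :=
        hcont.comp hbc fun t ht => (hball (hseg t ht)).2
      -- Continuous induction on `[0, 1]`: the good times form a closed set containing `0`, and by
      -- `IsFoliated.eventually_mem` good times exist immediately after each good `t < 1`.
      have hall : Icc (0 : ℝ) 1 ⊆ {t : ℝ | ψ (b.symm (b x₀ + t • v)) ∈ S} := by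
        refine IsClosed.Icc_subset_of_forall_exists_gt ?_ ?_ ?_
        · rw [inter_comm]
          exact hfc.preimage_isClosed_of_isClosed isClosed_Icc hSc
        · simpa [b.left_inv hx₀b] using hx₀S
        · rintro t ⟨htS, ht⟩ y hy
          have ht' : t ∈ Icc (0 : ℝ) 1 := ⟨ht.1, ht.2.le⟩
          have hadd : ∀ s : ℝ, b x₀ + t • v + s • v = b x₀ + (t + s) • v := fun s => by
            rw [add_smul, add_assoc]
          -- The increment has to stay below `y`, as the induction principle demands, and below the
          -- end of the segment, to remain in the ball.
          have hy' : (0 : ℝ) < min (y - t) (1 - t) :=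
            lt_min (sub_pos.2 hy) (sub_pos.2 ht.2)
          have hsU : ∀ᶠ s in 𝓝[>] (0 : ℝ), b.symm (b x₀ + t • v + s • v) ∈ U := by
            filter_upwards [Ioo_mem_nhdsGT hy'] with s hs
            rw [hadd]
            exact (hball (hseg _ ⟨add_nonneg ht.1 hs.1.le, by
              linarith [hs.2.trans_le (min_le_right (y - t) (1 - t))]⟩)).2
          have hcs : ContinuousWithinAt (fun s : ℝ => ψ (b.symm (b x₀ + t • v + s • v)))
              (Ioi 0) 0 := by
            refine ContinuousAt.continuousWithinAt (ContinuousAt.comp (g := ψ) ?_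
              (ContinuousAt.comp (g := b.symm) ?_ (by fun_prop)))
            all_goals rw [zero_smul, add_zero]
            · exact hcont.continuousAt (hψ.isOpen.mem_nhds (hball (hseg t ht')).2)
            · exact b.symm.continuousAt (hball (hseg t ht')).1
          have := hS.eventually_mem hρ hD hT hbs hψ (hball (hseg t ht')).1 hsU hcs htS
            (hψ.right_inv _ (hball (hseg t ht')).2)
          obtain ⟨s, hsS, hs⟩ := (this.and (Ioo_mem_nhdsGT hy')).exists
          refine ⟨t + s, ?_, by linarith [hs.1], by
            linarith [hs.2.trans_le (min_le_left (y - t) (1 - t))]⟩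
          rwa [hadd] at hsS
      have := hall (right_mem_Icc.2 zero_le_one)
      simpa [hv] using this
    filter_upwards [hψ.isOpen.mem_nhds hx₀, b.open_source.mem_nhds hx₀b,
      (b.continuousAt hx₀b).eventually_mem (Metric.ball_mem_nhds _ hr)] with x h1 h2 h3
    refine ⟨h1, ?_⟩
    have := hmem _ h3
    rwa [b.left_inv h2] at this
  have hopen' : IsOpen (U ∩ ψ ⁻¹' Sᶜ) := hcont.isOpen_inter_preimage hψ.isOpen hSc.isOpen_compl
  have hsub := IsPreconnected.subset_left_of_subset_union hopen hopen'
    (disjoint_left.2 fun x h h' => h'.2 h.2)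
    (fun x hx => (em (ψ x ∈ S)).imp (fun h => ⟨hx, h⟩) (fun h => ⟨hx, h⟩))
    (hne.imp fun x hx => ⟨hx.1, hx.1, hx.2⟩) hU
  exact fun x hx => (hsub hx).2

/-- An integral section with boundary conditions in a foliated set meets this set. -/
lemma IsFoliated.exists_mem_of_boundaryConditions [T2Space M] (hS : IsFoliated m ρ D S)
    (hρ : ContMDiff 𝓘(ℝ, H) 𝓘(ℝ, RSpace m) ∞ ρ)
    (hD : IsSmoothDistribution m D) (hT : IsTransverse (m := m) ρ D)
    (hψ : IsIntegralSection (m := m) ρ D U ψ) (hbc : HasBoundaryConditionsIn U ψ S) :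
    ∃ x ∈ U, ψ x ∈ S := by
  rcases hbc with h | ⟨O, hO, ⟨x₀, hx₀O, hx₀U⟩, hcont, hmaps⟩
  · exact h
  set b := chartAt (RSpace m) x₀ with hb
  have hbs : IsSmoothChart (RSpace m) b := isSmoothChart_chartAt x₀
  have hx₀b : x₀ ∈ b.source := mem_chart_source _ x₀
  obtain ⟨r, hr, hball⟩ := Metric.isOpen_iff.1 (b.symm.isOpen_inter_preimage hO) (b x₀)
    ⟨b.map_source hx₀b, by change b.symm (b x₀) ∈ O; rwa [b.left_inv hx₀b]⟩
  have hnhds : b.source ∩ b ⁻¹' Metric.ball (b x₀) r ∈ 𝓝 x₀ :=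
    Filter.inter_mem (b.open_source.mem_nhds hx₀b)
      ((b.continuousAt hx₀b).preimage_mem_nhds (Metric.ball_mem_nhds _ hr))
  -- A boundary point is a limit of points of `U`; take one, `x₁`, in a chart ball around `x₀` that
  -- corresponds to a subset of `O`.
  obtain ⟨x₁, ⟨hx₁b, hx₁r⟩, hx₁U⟩ := mem_closure_iff_nhds.1 (frontier_subset_closure hx₀U) _ hnhds
  set z := b x₁ with hz
  set v := z - b x₀ with hv
  have hseg : ∀ t ∈ Icc (0 : ℝ) 1, b x₀ + t • v ∈ Metric.ball (b x₀) r := fun t ht =>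
    (convex_ball _ _).add_smul_sub_mem (Metric.mem_ball_self hr) hx₁r ht
  have hbc : ContinuousOn (fun t : ℝ => b.symm (b x₀ + t • v)) (Icc 0 1) :=
    b.symm.continuousOn.comp (by fun_prop) fun t ht => (hball (hseg t ht)).1
  have hnot : x₀ ∉ U := fun h => by
    rw [hψ.isOpen.frontier_eq] at hx₀U
    exact hx₀U.2 h
  -- the last exit time from the complement of `U`
  set K : Set ℝ := Icc 0 1 ∩ (fun t : ℝ => b.symm (b x₀ + t • v)) ⁻¹' Uᶜ with hK
  have hKc : IsCompact K := isCompact_Icc.of_isClosed_subset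
    (hbc.preimage_isClosed_of_isClosed isClosed_Icc hψ.isOpen.isClosed_compl) inter_subset_left
  have hK0 : (0 : ℝ) ∈ K := ⟨left_mem_Icc.2 zero_le_one, by simpa [b.left_inv hx₀b] using hnot⟩
  obtain ⟨t, ⟨ht, htU⟩, hmax⟩ := hKc.exists_isGreatest ⟨0, hK0⟩
  have hone : b.symm (b x₀ + (1 : ℝ) • v) ∈ U := by
    simpa [hv, hz, b.left_inv hx₁b] using hx₁U
  have ht1 : t < 1 := lt_of_le_of_ne ht.2 fun h => htU (by simpa [h] using hone)
  have hafter : ∀ s ∈ Ioc t 1, b.symm (b x₀ + s • v) ∈ U := fun s hs => by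
    by_contra h
    exact absurd (hmax ⟨⟨ht.1.trans hs.1.le, hs.2⟩, h⟩) (not_le.2 hs.1)
  have hadd : ∀ s : ℝ, b x₀ + t • v + s • v = b x₀ + (t + s) • v := fun s => by
    rw [add_smul, add_assoc]
  have hsU : ∀ᶠ s in 𝓝[>] (0 : ℝ), b.symm (b x₀ + t • v + s • v) ∈ U := by
    filter_upwards [Ioo_mem_nhdsGT (sub_pos.2 ht1)] with s hs
    rw [hadd]
    exact hafter _ ⟨by linarith [hs.1], by linarith [hs.2]⟩
  set y := b.symm (b x₀ + t • v) with hy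
  have hyt := (hball (hseg t ht)).1
  have hbl : Filter.Tendsto (fun s : ℝ => b.symm (b x₀ + t • v + s • v)) (𝓝[>] 0) (𝓝 y) := by
    have : ContinuousAt (fun s : ℝ => b.symm (b x₀ + t • v + s • v)) 0 := by
      refine ContinuousAt.comp (g := b.symm) ?_ (by fun_prop)
      rw [zero_smul, add_zero]; exact b.symm.continuousAt hyt
    have h := this.tendsto.mono_left (nhdsWithin_le_nhds (s := Ioi 0))
    rwa [zero_smul, add_zero] at h
  -- The segment from `x₀` to `x₁` may leave and re-enter `U`, so `x₀` is replaced by `y`, after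
  -- which the segment stays in `U`. The ball keeps `y` in `O`, so the boundary values in `S` are
  -- available there.
  have hyF : y ∈ O ∩ frontier U := by
    refine ⟨(hball (hseg t ht)).2, ?_⟩
    rw [hψ.isOpen.frontier_eq]
    exact ⟨mem_closure_of_tendsto hbl hsU, htU⟩
  have hψl : Filter.Tendsto (fun s : ℝ => ψ (b.symm (b x₀ + t • v + s • v))) (𝓝[>] 0)
      (𝓝 (ψ y)) :=
    (hcont y (Or.inr hyF)).tendsto.comp
      (tendsto_nhdsWithin_iff.2 ⟨hbl, hsU.mono fun s hs => Or.inl hs⟩)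
  -- The section identity is given only on `U`; at `y` it follows by passing to the limit in the
  -- Hausdorff space `M`.
  have hρy : ρ (ψ y) = y := by
    refine tendsto_nhds_unique ((hρ.continuous.tendsto _).comp hψl) (hbl.congr' ?_)
    filter_upwards [hsU] with s hs using (hψ.right_inv _ hs).symm
  have hcs : ContinuousWithinAt (fun s : ℝ => ψ (b.symm (b x₀ + t • v + s • v))) (Ioi 0) 0 := by
    change Filter.Tendsto _ _ (𝓝 (ψ (b.symm (b x₀ + t • v + (0 : ℝ) • v))))
    rw [zero_smul, add_zero]
    exact hψl
  obtain ⟨s, hs, hsS⟩ := (hsU.and (hS.eventually_mem hρ hD hT hbs hψ hyt hsU hcs (hmaps hyF)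
    hρy)).exists
  exact ⟨_, hs, hsS⟩

end Propagation

/-! ### Projecting integral sections along a lifting section -/

section Projection

variable {m : ℕ} {M : Type*} [TopologicalSpace M] [T2Space M] [ChartedSpace (RSpace m) M]
  [IsManifold 𝓘(ℝ, RSpace m) ∞ M]
  {H : Type*} [NormedAddCommGroup H] [NormedSpace ℝ H]
  {N : Type*} [TopologicalSpace N] [ChartedSpace H N] [IsManifold 𝓘(ℝ, H) ∞ N]
  {H' : Type*} [NormedAddCommGroup H'] [NormedSpace ℝ H']
  {E : Type*} [TopologicalSpace E] [ChartedSpace H' E] [IsManifold 𝓘(ℝ, H') ∞ E]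
  {D : ∀ p : N, Submodule ℝ (TangentSpace 𝓘(ℝ, H) p)}
  {D' : ∀ u : E, Submodule ℝ (TangentSpace 𝓘(ℝ, H') u)}
  {π : E → M} {pr : N → E} {σ : E → N}

/-- If the integral sections of `D'`, the projection of `D` along a section `σ` of `pr : N → E`, are
lifted by `σ` to integral sections of `D`, then the integral sections of `D` with boundary conditions
in the image of `σ` project to the integral sections of `D'`. -/
theorem IsIntegralSection.proj_of_boundaryConditions [T2Space N]
    (hπ : ContMDiff 𝓘(ℝ, H') 𝓘(ℝ, RSpace m) ∞ π) (hpr : ContMDiff 𝓘(ℝ, H) 𝓘(ℝ, H') ∞ pr)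
    (hσ : Continuous σ) (hprσ : ∀ u, pr (σ u) = u)
    (hD : IsSmoothDistribution m D) (hT : IsTransverse (m := m) (fun q => π (pr q)) D)
    (hD' : ∀ q : N, σ (pr q) = q →
      D' (pr q) = (D q).map (mfderiv 𝓘(ℝ, H) 𝓘(ℝ, H') pr q).toLinearMap)
    (hint : IsIntegrable (m := m) π D')
    (hlift : ∀ (U : Set M) (γ : M → E), IsIntegralSection (m := m) π D' U γ →
      IsIntegralSection (m := m) (fun q => π (pr q)) D U (σ ∘ γ))
    {U : Set M} {ψ : M → N} (hU : IsPreconnected U)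
    (hψ : IsIntegralSection (m := m) (fun q => π (pr q)) D U ψ)
    (hbc : HasBoundaryConditionsIn U ψ (range σ)) :
    IsIntegralSection (m := m) π D' U (pr ∘ ψ) := by
  -- Through `σ u` passes `σ ∘ γ`, where `γ` is an integral section of `D'` through `u`.
  have hS : IsFoliated m (fun q => π (pr q)) D (range σ) := by
    rintro _ ⟨u, rfl⟩
    obtain ⟨W, γ, hW, hγu, hγ⟩ := hint u
    refine ⟨W, σ ∘ γ, by simpa [hprσ] using hW, by simp [hprσ, hγu], hlift W γ hγ, ?_⟩
    exact fun x _ => ⟨_, rfl⟩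
  -- The image of a section is the equalizer of `σ ∘ pr` and the identity, closed because `N` is
  -- Hausdorff.
  have hSc : IsClosed (range σ) := by
    have : range σ = {q | σ (pr q) = q} := by
      ext q
      exact ⟨by rintro ⟨u, rfl⟩; simp [hprσ], fun h => ⟨_, h⟩⟩
    rw [this]
    exact isClosed_eq (hσ.comp hpr.continuous) continuous_id
  have hρ : ContMDiff 𝓘(ℝ, H) 𝓘(ℝ, RSpace m) ∞ (fun q => π (pr q)) := hπ.comp hpr
  have hmaps := hS.mapsTo hSc hρ hD hT hU hψ
    (hS.exists_mem_of_boundaryConditions hρ hD hT hψ hbc)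
  refine ⟨⟨hψ.isOpen, hpr.comp_contMDiffOn hψ.smooth, hψ.right_inv⟩, fun x hx => ?_⟩
  -- `D'` is tied to `D` only at points of the image of `σ`; this places `ψ x` there.
  have hx' : σ (pr (ψ x)) = ψ x := by
    obtain ⟨u, hu⟩ := hmaps hx
    rw [← hu, hprσ]
  have hc : mfderiv 𝓘(ℝ, RSpace m) 𝓘(ℝ, H') (pr ∘ ψ) x =
      (mfderiv 𝓘(ℝ, H) 𝓘(ℝ, H') pr (ψ x)).comp (mfderiv 𝓘(ℝ, RSpace m) 𝓘(ℝ, H) ψ x) :=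
    mfderiv_comp x (hpr.mdifferentiableAt (by simp))
      ((hψ.smooth.contMDiffAt (hψ.isOpen.mem_nhds hx)).mdifferentiableAt (by simp))
  have hr := hψ.tangent x hx
  change _ = D' (pr (ψ x))
  rw [hD' _ hx', ← hr, hc]
  exact LinearMap.range_comp _ _

end Projection

/-! ### Smooth projections and Hausdorffness of the two jet bundles -/

/-- A locally Euclidean space fibered over a Hausdorff space is Hausdorff if each fibre lies in the
domain of a chart. -/
lemma t2Space_of_fiber_subset_chart {H N E : Type*} [TopologicalSpace H] [T2Space H]
    [TopologicalSpace N] [ChartedSpace H N] [TopologicalSpace E] [T2Space E] {f : N → E}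
    (hf : Continuous f) (h : ∀ q q', f q = f q' → q' ∈ (chartAt H q).source) : T2Space N := by
  refine ⟨fun q q' hne => ?_⟩
  by_cases hq : f q = f q'
  · have hs := mem_chart_source H q
    have hs' := h q q' hq
    obtain ⟨A, B, hA, hB, hqA, hqB, hAB⟩ :=
      t2_separation fun he => hne ((chartAt H q).injOn hs hs' he)
    exact ⟨_, _, (chartAt H q).isOpen_inter_preimage hA, (chartAt H q).isOpen_inter_preimage hB,
      ⟨hs, hqA⟩, ⟨hs', hqB⟩, (hAB.preimage _).mono inter_subset_right inter_subset_right⟩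
  · exact separated_by_continuous hf hq

variable {m n : ℕ}
  {M : Type*} [TopologicalSpace M] [ChartedSpace (RSpace m) M] [IsManifold 𝓘(ℝ, RSpace m) ∞ M]
  {E : Type*} [TopologicalSpace E] [ChartedSpace (RSpace (m + n)) E]
  [IsManifold 𝓘(ℝ, RSpace (m + n)) ∞ E]
  {π : E → M} [FiberedManifold m n π]

/-- A map `f : N → E` which reads `(z, y) ↦ z` in the preferred charts of `N` and adapted charts of
`E` is smooth. -/
lemma contMDiff_of_chart_fst {F : Type*} [NormedAddCommGroup F] [NormedSpace ℝ F]
    {N : Type*} [TopologicalSpace N] [ChartedSpace ((RSpace m × RSpace n) × F) N]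
    [IsManifold 𝓘(ℝ, (RSpace m × RSpace n) × F) ∞ N] {f : N → E}
    (h : ∀ q : N, ∃ a : AdaptedChart m n π,
      ∀ p ∈ (chartAt ((RSpace m × RSpace n) × F) q).source,
        f p ∈ a.tot.source ∧ (chartAt ((RSpace m × RSpace n) × F) q p).1 = a.tot (f p)) :
    ContMDiff 𝓘(ℝ, (RSpace m × RSpace n) × F) 𝓘(ℝ, RSpace (m + n)) ∞ f := by
  intro q
  obtain ⟨a, ha⟩ := h q
  set c := chartAt ((RSpace m × RSpace n) × F) q
  have h1 : ContMDiffOn 𝓘(ℝ, (RSpace m × RSpace n) × F) 𝓘(ℝ, RSpace m × RSpace n) ∞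
      (fun p => (c p).1) c.source :=
    (contDiff_fst.contMDiff (n := ∞)).comp_contMDiffOn contMDiffOn_chart
  have h2 : ContMDiffOn 𝓘(ℝ, (RSpace m × RSpace n) × F) 𝓘(ℝ, RSpace (m + n)) ∞ f c.source := by
    refine (a.smooth_tot.smooth_symm.comp h1 fun p hp => ?_).congr fun p hp => ?_
    · change (c p).1 ∈ a.tot.target
      rw [(ha p hp).2]; exact a.tot.map_source (ha p hp).1
    · simp only [Function.comp, (ha p hp).2, a.tot.left_inv (ha p hp).1]
  exact h2.contMDiffAt (c.open_source.mem_nhds (mem_chart_source _ q))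

lemma contMDiff_jetProj :
    ContMDiff 𝓘(ℝ, JetModel m n) 𝓘(ℝ, RSpace (m + n)) ∞ (jetProj : Jet m n π → E) :=
  contMDiff_of_chart_fst fun j => ⟨chartNear m n π j.pt, fun _ hp => ⟨hp, rfl⟩⟩

lemma contMDiff_dualProj :
    ContMDiff 𝓘(ℝ, DualJetModel m n) 𝓘(ℝ, RSpace (m + n)) ∞ (dualProj : DualJet m n π → E) :=
  contMDiff_of_chart_fst fun j => ⟨chartNear m n π j.pt, fun _ hp => ⟨hp, rfl⟩⟩

/-- The preferred charts are defined over whole preimages of open sets of `E`, so they contain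
entire fibres. Hausdorffness is what makes the image of a section closed. -/
instance [T2Space E] : T2Space (Jet m n π) :=
  t2Space_of_fiber_subset_chart (H := JetModel m n) contMDiff_jetProj.continuous fun j j' h => by
    change j'.pt ∈ (chartNear m n π j.pt).tot.source
    rw [← show j.pt = j'.pt from h]
    exact mem_chartNear j.pt

instance [T2Space E] : T2Space (DualJet m n π) :=
  t2Space_of_fiber_subset_chart (H := DualJetModel m n) contMDiff_dualProj.continuous
    fun j j' h => by
      change j'.pt ∈ (chartNear m n π j.pt).tot.source
      rw [← show j.pt = j'.pt from h]
      exact mem_chartNear j.pt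

/-! ### The projected distribution in the Lagrangian case -/

/-- If `A` is the `1`-jet at `x` of a local section `φ` then the image of `T_x φ` is that of `A`. -/
lemma IsLocalSection.range_mfderiv {U : Set M} {φ : M → E}
    (hφ : IsLocalSection (m := m) (H := RSpace (m + n)) π U φ) {x : M} (hx : x ∈ U)
    {A : JetFiber m n π (φ x)} (hA : IsJetAt φ x A) :
    (mfderiv 𝓘(ℝ, RSpace m) 𝓘(ℝ, RSpace (m + n)) φ x).range = A.1.range := by
  have hid : mfderiv 𝓘(ℝ, RSpace m) 𝓘(ℝ, RSpace m) (fun y => π (φ y)) x =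
      mfderiv 𝓘(ℝ, RSpace m) 𝓘(ℝ, RSpace m) (id : M → M) x := by
    apply Filter.EventuallyEq.mfderiv_eq
    filter_upwards [hφ.isOpen.mem_nhds hx] with y hy using hφ.right_inv y hy
  -- `IsJetAt` contains the factor `T_x(π ∘ φ)`. Its surjectivity is enough for comparing images,
  -- and the tangent spaces at `x` and `π (φ x)` need not be identified.
  have hsurj : (mfderiv 𝓘(ℝ, RSpace m) 𝓘(ℝ, RSpace m) (fun y => π (φ y)) x).range = ⊤ := by
    refine LinearMap.range_eq_top.2 fun v => ⟨v, ?_⟩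
    exact (DFunLike.congr_fun hid v).trans (DFunLike.congr_fun (mfderiv_id (x := x)) v)
  have h1 := congrArg (fun T : TangentSpace 𝓘(ℝ, RSpace m) x →L[ℝ]
    TangentSpace 𝓘(ℝ, RSpace (m + n)) (φ x) => T.range) hA
  refine h1.symm.trans ?_
  exact LinearMap.range_comp_of_range_eq_top _ hsurj

/-- The projection to `E` of a holonomic integrable distribution in `J¹π` along a jet field `Ψ` is the
distribution of `Ψ`. -/
lemma SolvesLagrangianProblem.jetProjected_eq
    {η : ∀ x : M, TangentSpace 𝓘(ℝ, RSpace m) x [⋀^Fin m]→L[ℝ] ℝ} {L : Jet m n π → ℝ}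
    {D : ∀ j : Jet m n π, Submodule ℝ (TangentSpace 𝓘(ℝ, JetModel m n) j)}
    (hD : SolvesLagrangianProblem η L D) (Ψ : ∀ u : E, JetFiber m n π u) (u : E) :
    jetProjected D Ψ u = (Ψ u).1.range := by
  -- One integral section through `Ψ u` suffices. It has the form `j¹φ`, so `Tπ¹` sends its tangent
  -- space to the image of `Tφ`, which is the image of the jet `Ψ u`.
  obtain ⟨U, ψ, hU, hψu, hψ⟩ := hD.isIntegrable ⟨u, Ψ u⟩
  obtain ⟨φ, hφ, hpr⟩ := hD.holonomic U ψ hψ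
  set x := jetBase (⟨u, Ψ u⟩ : Jet m n π) with hx
  obtain ⟨A, hA, hψA⟩ := hpr x hU
  have hA' : (⟨u, Ψ u⟩ : Jet m n π) = ⟨φ x, A⟩ := hψu.symm.trans hψA
  have hc : mfderiv 𝓘(ℝ, RSpace m) 𝓘(ℝ, RSpace (m + n)) (jetProj ∘ ψ) x =
      (tangentJetProj (ψ x)).comp (mfderiv 𝓘(ℝ, RSpace m) 𝓘(ℝ, JetModel m n) ψ x) :=
    mfderiv_comp x (contMDiff_jetProj.mdifferentiableAt (by simp))
      ((hψ.smooth.contMDiffAt (hψ.isOpen.mem_nhds hU)).mdifferentiableAt (by simp))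
  have hφψ : mfderiv 𝓘(ℝ, RSpace m) 𝓘(ℝ, RSpace (m + n)) (jetProj ∘ ψ) x =
      mfderiv 𝓘(ℝ, RSpace m) 𝓘(ℝ, RSpace (m + n)) φ x := by
    apply Filter.EventuallyEq.mfderiv_eq
    filter_upwards [hψ.isOpen.mem_nhds hU] with y hy
    obtain ⟨B, -, hB⟩ := hpr y hy
    simp [hB, jetProj]
  have h1 : (D (ψ x)).map (tangentJetProj (ψ x)).toLinearMap =
      (mfderiv 𝓘(ℝ, RSpace m) 𝓘(ℝ, RSpace (m + n)) (jetProj ∘ ψ) x).range := by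
    rw [← hψ.tangent x hU, hc]
    exact (LinearMap.range_comp _ _).symm
  have h2 : (mfderiv 𝓘(ℝ, RSpace m) 𝓘(ℝ, RSpace (m + n)) (jetProj ∘ ψ) x).range = A.1.range :=
    (congrArg (fun T : RSpace m →L[ℝ] RSpace (m + n) => T.range) hφψ).trans
      (hφ.range_mfderiv hU hA)
  have h3 : (D (ψ x)).map (tangentJetProj (ψ x)).toLinearMap = (ψ x).lin.1.range := by
    have h4 : (ψ x).lin.1.range = (⟨φ x, A⟩ : Jet m n π).lin.1.range := by rw [hψA]
    exact (h1.trans h2).trans h4.symm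
  -- The tangent spaces depend on the jet, so the identity at `ψ x` is moved to `(u, Ψ u)` by
  -- generalizing over the jet and substituting.
  have h5 : ∀ j : Jet m n π, j = ⟨u, Ψ u⟩ →
      (D j).map (tangentJetProj j).toLinearMap = j.lin.1.range →
      jetProjected D Ψ u = (Ψ u).1.range := by
    rintro _ rfl h
    exact h
  exact h5 _ hψu h3

/-- A section `γ` with `j¹γ = Ψ ∘ γ` is tangent to the images of the jets `Ψ (γ x)`, and these form
the projected distribution by `jetProjected_eq`. -/
lemma SolvesLagrangianProblem.isIntegrable_jetProjected
    {η : ∀ x : M, TangentSpace 𝓘(ℝ, RSpace m) x [⋀^Fin m]→L[ℝ] ℝ} {L : Jet m n π → ℝ}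
    {D : ∀ j : Jet m n π, Submodule ℝ (TangentSpace 𝓘(ℝ, JetModel m n) j)}
    (hD : SolvesLagrangianProblem η L D) {Ψ : ∀ u : E, JetFiber m n π u}
    (hΨ : IsIntegrableJetField Ψ) : IsIntegrable (m := m) π (jetProjected D Ψ) := by
  intro u
  obtain ⟨U, γ, hγ, hU, hγu, hjet⟩ := hΨ u
  refine ⟨U, γ, hU, hγu, hγ, fun x hx => ?_⟩
  rw [hD.jetProjected_eq Ψ, hγ.range_mfderiv hx (hjet x hx)]

end FieldTheory
end

/-! ### The two cases of the Hamilton–Jacobi theorem -/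

theorem mainTheorem9 {m n : ℕ}
    {M : Type*} [TopologicalSpace M] [T2Space M] [SecondCountableTopology M]
    [ChartedSpace (FieldTheory.RSpace m) M]
    [IsManifold 𝓘(ℝ, FieldTheory.RSpace m) ∞ M]
    {E : Type*} [TopologicalSpace E] [T2Space E] [SecondCountableTopology E]
    [ChartedSpace (FieldTheory.RSpace (m + n)) E]
    [IsManifold 𝓘(ℝ, FieldTheory.RSpace (m + n)) ∞ E]
    (π : E → M) [FieldTheory.FiberedManifold m n π]
    (η : ∀ x : M, TangentSpace 𝓘(ℝ, FieldTheory.RSpace m) x [⋀^Fin m]→L[ℝ] ℝ)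
    (hη : FieldTheory.IsVolumeForm η) :
    -- Lagrangian formalism
    (∀ (L : FieldTheory.Jet m n π → ℝ),
      ContMDiff 𝓘(ℝ, FieldTheory.JetModel m n) 𝓘(ℝ, ℝ) ∞ L →
      ∀ (D_L : ∀ j : FieldTheory.Jet m n π,
          Submodule ℝ (TangentSpace 𝓘(ℝ, FieldTheory.JetModel m n) j)),
      FieldTheory.SolvesLagrangianProblem η L D_L →
      ∀ (Ψ : ∀ u : E, FieldTheory.JetFiber m n π u),
      FieldTheory.SolvesGeneralizedLagrangianHJ D_L Ψ →
      (∀ (U : Set M) (ψ : M → FieldTheory.Jet m n π), IsPreconnected U →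
        FieldTheory.IsIntegralSection (m := m) FieldTheory.jetBase D_L U ψ →
        FieldTheory.HasBoundaryConditionsIn U ψ (range (FieldTheory.jetLift Ψ)) →
        FieldTheory.IsIntegralSection (m := m) π (FieldTheory.jetProjected D_L Ψ) U
          (FieldTheory.jetProj ∘ ψ)) ∧
      (∀ (U : Set M) (γ : M → E),
        FieldTheory.IsIntegralSection (m := m) π (FieldTheory.jetProjected D_L Ψ) U γ →
        ∃ ψ : M → FieldTheory.Jet m n π,
          FieldTheory.IsIntegralSection (m := m) FieldTheory.jetBase D_L U ψ ∧
          MapsTo ψ U (range (FieldTheory.jetLift Ψ)) ∧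
          EqOn (FieldTheory.jetProj ∘ ψ) γ U)) ∧
    -- Hamiltonian formalism
    (∀ (h : FieldTheory.HamiltonianSection m n π)
      (D_h : ∀ q : FieldTheory.DualJet m n π,
          Submodule ℝ (TangentSpace 𝓘(ℝ, FieldTheory.DualJetModel m n) q)),
      FieldTheory.SolvesHamiltonianProblem h D_h →
      ∀ (s : ∀ u : E, FieldTheory.ReducedForms
          (mfderiv 𝓘(ℝ, FieldTheory.RSpace (m + n)) 𝓘(ℝ, FieldTheory.RSpace m) π u) m),
      FieldTheory.SolvesGeneralizedHamiltonianHJ D_h s →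
      (∀ (U : Set M) (ψ : M → FieldTheory.DualJet m n π), IsPreconnected U →
        FieldTheory.IsIntegralSection (m := m) FieldTheory.dualBase D_h U ψ →
        FieldTheory.HasBoundaryConditionsIn U ψ (range (FieldTheory.dualLift s)) →
        FieldTheory.IsIntegralSection (m := m) π (FieldTheory.dualProjected D_h s) U
          (FieldTheory.dualProj ∘ ψ)) ∧
      (∀ (U : Set M) (γ : M → E),
        FieldTheory.IsIntegralSection (m := m) π (FieldTheory.dualProjected D_h s) U γ →
        ∃ ψ : M → FieldTheory.DualJet m n π,
          FieldTheory.IsIntegralSection (m := m) FieldTheory.dualBase D_h U ψ ∧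
          MapsTo ψ U (range (FieldTheory.dualLift s)) ∧
          EqOn (FieldTheory.dualProj ∘ ψ) γ U)) := by
  refine ⟨fun L _ D hD Ψ hΨ => ⟨fun U ψ hU hψ hbc => ?_, fun U γ hγ => ?_⟩,
    fun h D hD s hs => ⟨fun U ψ hU hψ hbc => ?_, fun U γ hγ => ?_⟩⟩
  · exact hψ.proj_of_boundaryConditions FieldTheory.FiberedManifold.contMDiff
      FieldTheory.contMDiff_jetProj hΨ.isSmooth.continuous (fun _ => rfl) hD.isSmooth
      hD.isTransverse (by
        -- On the image of the lift the projected distribution is the pushforward of `D` by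
        -- definition, once `q` is written as the lift of a point of `E`.
        intro q hq
        obtain ⟨u, rfl⟩ : ∃ u, FieldTheory.jetLift Ψ u = q := ⟨_, hq⟩
        rfl)
      (hD.isIntegrable_jetProjected hΨ.isIntegrable) hΨ.lifts hU hbc
  -- The witness is `Ψ ∘ γ`, an integral section by the Hamilton–Jacobi condition itself.
  · exact ⟨_, hΨ.lifts U γ hγ, fun x _ => ⟨γ x, rfl⟩, fun _ _ => rfl⟩
  · exact hψ.proj_of_boundaryConditions FieldTheory.FiberedManifold.contMDiff
      FieldTheory.contMDiff_dualProj hs.isSmooth.continuous (fun _ => rfl) hD.isSmooth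
      hD.isTransverse (by
        intro q hq
        obtain ⟨u, rfl⟩ : ∃ u, FieldTheory.dualLift s u = q := ⟨_, hq⟩
        rfl)
      hs.isIntegrable hs.lifts hU hbc
  · exact ⟨_, hs.lifts U γ hγ, fun x _ => ⟨γ x, rfl⟩, fun _ _ => rfl⟩
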